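/- **Setting.** Let $\mathcal W\subseteq\mathbb R^d$ be bounded, closed and convex, $m\ge 1$, $f:\mathcal W\to\mathbb R$ $\lambda$-strongly convex ($\lambda>0$) and $L_f$-Lipschitz, and $g_1,\dots,g_m:\mathcal W\to\mathbb R$ convex and $L_g$-Lipschitz ($L_g>0$), all with respect to $\|\cdot\|_2$. Put $g=\max_i g_i$, and let $\partial$ denote the subdifferential relative to $\mathcal W$. Assume that there is $\rho>0$ with $\|v\|_2\ge\rho$ whenever $w\in\mathcal W$, $g(w)=0$ and $v\in\partial g(w)$, and let $\gamma>0$ satisfy $\gamma>L_f/\rho$. Let $w^*$ be the minimizer of $f$ on $\{w\in\mathcal W: g_i(w)\le 0\ \forall i\}$ (assumed nonempty), let $\Pi_g$ and $\Pi_w$ be the Euclidean projections onto this set and onto $\mathcal W$, and write $\check\nabla\max\{0,g_i\}(w)$ for a (measurable) choice of a subgradient of $\max\{0,g_i\}$ at $w$. **Algorithm (MidTouch)**, with parameters $T_1,T_2\ge 1$ and $\eta=\lambda/(2\gamma^2L_g^2)$. Start from an arbitrary $w^{(1)}\in\mathcal W$. In every iteration $t$ a stochastic subgradient $\check\Delta^{(t)}$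 of $f$ is drawn: given the past, its conditional expectation lies in $\partial f(w^{(t)})$, and $\|\check\Delta^{(t)}\|_2\le G_f$ almost surely. *First phase*, $t=1,\dots,T_1$: evaluate all constraints at $w^{(t)}$, let $i$ be the index of a largest value, and set $w^{(t+1)}=\Pi_w\big(w^{(t)}-\tfrac1{\lambda t}(\check\Delta^{(t)}+\gamma\check\nabla\max\{0,g_i\}(w^{(t)}))\big)$. Then redefine $w^{(T_1+1)}=\frac1{T_1}\sum_{t=1}^{T_1}w^{(t)}$, let $p^{(T_1+1)}$ be the uniform distribution on $\{1,\dots,m\}$, and let $\mu_k^{(T_1+1)}=\max\{0,g_k(w^{(T_1+1)})\}$ for all $k$. *Second phase*, $t=T_1+1,\dots,T_1+T_2$: draw $i^{(t)}\sim p^{(t)}$ and $j^{(t)}$ uniformly from $\{1,\dots,m\}$ (given the past), and set, with $j=j^{(t)}$, $y=\max\{0,g_j(w^{(t)})\}$ and $\hat\Delta_p^{(t)}=\gamma\mu^{(t)}+\gamma m\,e_j(y-\mu^{(t)}_j)$, $$w^{(t+1)}=\Pi_w\Big(w^{(t)}-\tfrac1{\lambda t}\big(\check\Delta^{(t)}+\gamma\check\nabla\max\{0,g_{i^{(t)}}\}(w^{(t)})\big)\Big),\qquad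 p^{(t+1)}_k\propto p^{(t)}_k\exp\big(\eta\,\hat\Delta^{(t)}_{p,k}\big),$$ $\mu^{(t+1)}_j=y$ and $\mu^{(t+1)}_k=\mu^{(t)}_k$ for $k\ne j$. The result is $\bar w=\frac1{T_2}\sum_{t=T_1+1}^{T_1+T_2}w^{(t)}$, or its projection $\Pi_g(\bar w)$. A *constraint check* is one evaluation or one differentiation of a single $g_i$ (the final projection is not counted). Let $G_g$ be a bound for $\|\check\nabla\max\{0,g_i\}(w)\|_2$ over all $i$ and all $w\in\mathcal W$. **Theorem.** There are absolute constants $C>0$ and $a\in\mathbb N$ such that for all $m\ge1$, $\gamma,\lambda,L_g,\epsilon>0$ and $G_f,G_g\ge0$, with $$\Lambda=1+\ln\Big(1+\frac{(G_f+\gamma G_g+\gamma L_g)^2}{\lambda^2\epsilon}\Big),\qquad \ell=1+\ln m,$$ there are iteration counts $T_{\epsilon1},T_{\epsilon2}\ge1$, depending only on $m,\gamma,\lambda,L_g,G_f,G_g,\epsilon$, with $$T_{\epsilon1}\le C\Lambda^a\Big(1+\frac{m\,\ell^{2/3}(G_f+\gamma G_g+\gamma L_g)^{4/3}}{\lambda^{4/3}\epsilon^{2/3}}+\frac{m^2\,\ell\,(G_f+\gamma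 G_g)}{\lambda\sqrt\epsilon}\Big),$$ $$T_{\epsilon2}\le C\Lambda^a\Big(1+\frac{\ell\,(G_f+\gamma G_g+\gamma L_g)^2}{\lambda^2\epsilon}+\frac{m^{3/2}\ell^{3/2}(G_f+\gamma G_g)^{3/2}}{\lambda^{3/2}\epsilon^{3/4}}\Big),$$ such that, for every problem as above with these parameters, running MidTouch with $T_1=T_{\epsilon1}$ and $T_2=T_{\epsilon2}$ makes a total number of constraint checks of at most $$C\Lambda^a\Big(m+\frac{\ell\,(G_f+\gamma G_g+\gamma L_g)^2}{\lambda^2\epsilon}+\frac{m^{3/2}\ell^{3/2}(G_f+\gamma G_g)^{3/2}}{\lambda^{3/2}\epsilon^{3/4}}+\frac{m^2\ell^{2/3}(G_f+\gamma G_g+\gamma L_g)^{4/3}}{\lambda^{4/3}\epsilon^{2/3}}+\frac{m^3\,\ell\,(G_f+\gamma G_g)}{\lambda\sqrt\epsilon}\Big),$$ and $\|\Pi_g(\bar w)-w^*\|_2^2$ and $\|\bar w-w^*\|_2^2$ are integrable with $$\mathbb E\big[\|\Pi_g(\bar w)-w^*\|_2^2\big]\le\mathbb E\big[\|\bar w-w^*\|_2^2\big]\le\epsilon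 .$$ -/

import Mathlib

open MeasureTheory

noncomputable section

namespace MidTouch

/-- Euclidean space of dimension `d`. -/
abbrev Vec (d : ℕ) : Type := EuclideanSpace ℝ (Fin d)

/-- `v ∈ ∂φ(x)` for a function `φ` on the domain `W`. -/
def IsSubgradient {d : ℕ} (W : Set (Vec d)) (φ : Vec d → ℝ) (x v : Vec d) : Prop :=
  ∀ y ∈ W, φ x + inner ℝ v (y - x) ≤ φ y

/-- Euclidean projection onto `S`: a point of `S` nearest to `x`
(it exists and is unique if `S` is nonempty, closed and convex). -/
def proj {d : ℕ} (S : Set (Vec d)) (x : Vec d) : Vec d :=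
  Classical.epsilon fun y => y ∈ S ∧ ∀ z ∈ S, ‖x - y‖ ≤ ‖x - z‖

/-! ### The constrained problem -/

/-- The problem of minimizing `f` over `W` subject to `g i w ≤ 0` for the `m` indices `i`.
Only the values of `f` and `g i` on `W` matter. -/
structure Problem (d m : ℕ) where
  /-- the domain -/
  W : Set (Vec d)
  /-- the objective -/
  f : Vec d → ℝ
  /-- the constraint functions -/
  g : Fin m → Vec d → ℝ

/-- The combined constraint function `w ↦ max_i g_i(w)`. -/
def Problem.gmax {d m : ℕ} (P : Problem d m) (w : Vec d) : ℝ := ⨆ i, P.g i w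

/-- The feasible set. -/
def Problem.feasible {d m : ℕ} (P : Problem d m) : Set (Vec d) :=
  {w | w ∈ P.W ∧ ∀ i, P.g i w ≤ 0}

/-- `w` minimizes the objective over the feasible set. -/
def Problem.IsOptimum {d m : ℕ} (P : Problem d m) (w : Vec d) : Prop :=
  w ∈ P.feasible ∧ ∀ u ∈ P.feasible, P.f w ≤ P.f u

/-- The standing assumptions: a bounded closed convex domain, a `lam`-strongly convex and
`Lf`-Lipschitz objective, convex and `Lg`-Lipschitz constraints, and subgradients of norm at
least `rho > 0` of the combined constraint wherever that constraint vanishes. -/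
structure Problem.Admissible {d m : ℕ} (P : Problem d m) (lam Lf Lg rho : ℝ) : Prop where
  bounded : Bornology.IsBounded P.W
  closed : IsClosed P.W
  convex : Convex ℝ P.W
  strongConvex : StrongConvexOn P.W lam P.f
  lipschitz_f : ∀ w ∈ P.W, ∀ w' ∈ P.W, |P.f w - P.f w'| ≤ Lf * ‖w - w'‖
  convex_g : ∀ i, ConvexOn ℝ P.W (P.g i)
  lipschitz_g : ∀ i, ∀ w ∈ P.W, ∀ w' ∈ P.W, |P.g i w - P.g i w'| ≤ Lg * ‖w - w'‖
  rho_pos : 0 < rho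
  boundary : ∀ w ∈ P.W, P.gmax w = 0 → ∀ v, IsSubgradient P.W P.gmax w v → rho ≤ ‖v‖

/-- How the algorithm differentiates constraints: `grad i w` is the subgradient of `max{0, g_i}`
used at `w`, and `sel` picks the index of a largest entry of a vector of constraint values. -/
structure Oracle (d m : ℕ) where
  /-- the subgradients of the positive parts of the constraints -/
  grad : Fin m → Vec d → Vec d
  /-- the rule that selects a most violated constraint -/
  sel : (Fin m → ℝ) → Fin m

/-- The oracle answers correctly, and `Gg` bounds the norms of its subgradients. -/
structure Oracle.Valid {d m : ℕ} (O : Oracle d m) (P : Problem d m) (Gg : ℝ) : Prop where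
  subgradient : ∀ i, ∀ w ∈ P.W, IsSubgradient P.W (fun u => max 0 (P.g i u)) w (O.grad i w)
  norm_le : ∀ i, ∀ w ∈ P.W, ‖O.grad i w‖ ≤ Gg
  measurable_grad : ∀ i, Measurable (O.grad i)
  sel_max : ∀ (x : Fin m → ℝ) (i : Fin m), x i ≤ x (O.sel x)
  measurable_sel : Measurable O.sel

/-! ### Computations that count constraint checks -/

/-- A value together with the number of constraint checks spent on computing it. -/
structure Counted (α : Type) where
  /-- the result -/
  val : α
  /-- the number of constraint checks -/
  checks : ℕ

instance : Monad Counted where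
  pure a := ⟨a, 0⟩
  bind c k := ⟨(k c.val).val, c.checks + (k c.val).checks⟩

/-- Perform one computation for each index. -/
def Counted.all {m : ℕ} {α : Type} (c : Fin m → Counted α) : Counted (Fin m → α) :=
  ⟨fun i => (c i).val, ∑ i, (c i).checks⟩

/-- Evaluating one constraint is one check. -/
def evalConstraint {d m : ℕ} (P : Problem d m) (i : Fin m) (w : Vec d) : Counted ℝ :=
  ⟨P.g i w, 1⟩

/-- Differentiating one constraint is one check. -/
def diffConstraint {d m : ℕ} (O : Oracle d m) (i : Fin m) (w : Vec d) : Counted (Vec d) :=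
  ⟨O.grad i w, 1⟩

/-! ### The algorithm -/

/-- The hyperparameters: constraint scaling, strong convexity constant (which sets the steps
`1 / (lam * t)` of the `w`-update), step size of the `p`-update, and the lengths of the phases. -/
structure Hyper where
  /-- constraint scaling factor -/
  γ : ℝ
  /-- strong convexity constant -/
  lam : ℝ
  /-- step size of the `p`-update -/
  η : ℝ
  /-- number of iterations in the first phase -/
  T₁ : ℕ
  /-- number of iterations in the second phase -/
  T₂ : ℕ

/-- Everything drawn from outside by one execution: the initial point and, for each iteration
`t = 1, 2, …`, the stochastic subgradient of `f` and (in the second phase only) the indices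
`i^(t)` and `j^(t)`. -/
structure Draws (d m : ℕ) where
  /-- initial point -/
  w₁ : Vec d
  /-- stochastic subgradients of the objective -/
  sg : ℕ → Vec d
  /-- index of the constraint used in the `w`-update -/
  i : ℕ → Fin m
  /-- index of the constraint used in the `p`-update -/
  j : ℕ → Fin m

section Algorithm

variable {d m : ℕ} (P : Problem d m) (O : Oracle d m) (H : Hyper) (D : Draws d m)

/-- The projected step of iteration `t` from `w`, with `v` a subgradient of the positive part
of a constraint. -/
def wUpdate (t : ℕ) (w v : Vec d) : Vec d :=
  proj P.W (w - (1 / (H.lam * t)) • (D.sg t + H.γ • v))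

/-- `firstPhase n` computes `w^(n+1)`: in each iteration all constraints are evaluated, and one
with the largest value is differentiated. -/
def firstPhase : ℕ → Counted (Vec d)
  | 0 => pure D.w₁
  | n + 1 => do
    let w ← firstPhase n
    let x ← Counted.all fun i => evalConstraint P i w
    let v ← diffConstraint O (O.sel x) w
    return wUpdate P H D (n + 1) w v

/-- The average of the iterates `w^(1), …, w^(T₁)` of the first phase. -/
def firstAverage : Vec d :=
  (1 / (H.T₁ : ℝ)) • ∑ n ∈ Finset.range H.T₁, (firstPhase P O H D n).val

/-- The state of the second phase: the iterate `w`, the distribution `p` on the constraints, and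
the remembered positive parts `mu` of the constraint values. -/
structure State (d m : ℕ) where
  /-- current iterate -/
  w : Vec d
  /-- current distribution on the constraint indices -/
  p : Fin m → ℝ
  /-- remembered values -/
  mu : Fin m → ℝ

/-- The stochastic supergradient
`γ μ + γ m e_j (y - μ_j)`, where `y` is the current value of `max{0, g_j}`. -/
def pGradient (mu : Fin m → ℝ) (j : Fin m) (y : ℝ) : Fin m → ℝ :=
  fun k => H.γ * mu k + if k = j then H.γ * m * (y - mu j) else 0

/-- The multiplicative update along `s`, followed by normalization in the `1`-norm. -/
def pUpdate (p s : Fin m → ℝ) : Fin m → ℝ :=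
  let q : Fin m → ℝ := fun k => Real.exp (Real.log (p k) + H.η * s k)
  fun k => q k / ∑ l, |q l|

/-- Iteration `t` of the second phase. -/
def secondStep (t : ℕ) (s : State d m) : Counted (State d m) := do
  let v ← diffConstraint O (D.i t) s.w
  let x ← evalConstraint P (D.j t) s.w
  return {
    w := wUpdate P H D t s.w v
    p := pUpdate H s.p (pGradient H s.mu (D.j t) (max 0 x))
    mu := Function.update s.mu (D.j t) (max 0 x) }

/-- `secondPhase n` computes the state at the beginning of iteration `T₁ + n + 1`. The checks
made in the first phase and in the initialization are included in the count. -/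
def secondPhase : ℕ → Counted (State d m)
  | 0 => do
    let _ ← firstPhase P O H D H.T₁
    let w := firstAverage P O H D
    let x ← Counted.all fun k => evalConstraint P k w
    return { w := w, p := fun _ => 1 / (m : ℝ), mu := fun k => max 0 (x k) }
  | n + 1 => do
    let s ← secondPhase n
    secondStep P O H D (H.T₁ + n + 1) s

/-- The result `w̄`: the average of the second-phase iterates `w^(T₁+1), …, w^(T₁+T₂)`. -/
def average : Vec d :=
  (1 / (H.T₂ : ℝ)) • ∑ n ∈ Finset.range H.T₂, (secondPhase P O H D n).val.w

/-- The number of constraint checks made by the whole execution (the single final projection onto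
the feasible set is not a constraint check). -/
def totalChecks : ℕ := (secondPhase P O H D H.T₂).checks

end Algorithm

/-- The random draws `D` on the probability space `(Ω, μ)` follow the sampling rules of the
algorithm: given the past `F (t - 1)` of iteration `t`, the stochastic subgradient has a
conditional expectation in `∂f(w^(t))` and is bounded in norm by `Gf`; in the second phase moreover
`i^(t)` has conditional distribution `p^(t)` and `j^(t)` is uniform. The draws of iteration `t` are
known at time `t`. -/
structure IsRun {d m : ℕ} {Ω : Type*} {mΩ : MeasurableSpace Ω} (μ : Measure Ω)
    (F : Filtration ℕ mΩ) (P : Problem d m) (O : Oracle d m) (H : Hyper) (Gf : ℝ)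
    (D : Ω → Draws d m) : Prop where
  init_mem : ∀ ω, (D ω).w₁ ∈ P.W
  init_meas : Measurable[F 0] fun ω => (D ω).w₁
  sg_meas : ∀ t, 1 ≤ t → t ≤ H.T₁ + H.T₂ → Measurable[F t] fun ω => (D ω).sg t
  i_meas : ∀ t, H.T₁ + 1 ≤ t → t ≤ H.T₁ + H.T₂ → Measurable[F t] fun ω => (D ω).i t
  j_meas : ∀ t, H.T₁ + 1 ≤ t → t ≤ H.T₁ + H.T₂ → Measurable[F t] fun ω => (D ω).j t
  sg_bound : ∀ t, 1 ≤ t → t ≤ H.T₁ + H.T₂ → ∀ᵐ ω ∂μ, ‖(D ω).sg t‖ ≤ Gf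
  sg_first : ∀ n < H.T₁, ∀ᵐ ω ∂μ,
    IsSubgradient P.W P.f (firstPhase P O H (D ω) n).val
      ((μ[fun ω' => (D ω').sg (n + 1) | F n]) ω)
  sg_second : ∀ n < H.T₂, ∀ᵐ ω ∂μ,
    IsSubgradient P.W P.f (secondPhase P O H (D ω) n).val.w
      ((μ[fun ω' => (D ω').sg (H.T₁ + n + 1) | F (H.T₁ + n)]) ω)
  i_law : ∀ n < H.T₂, ∀ k : Fin m, ∀ᵐ ω ∂μ,
    (μ[fun ω' => if (D ω').i (H.T₁ + n + 1) = k then (1 : ℝ) else 0 | F (H.T₁ + n)]) ω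
      = (secondPhase P O H (D ω) n).val.p k
  j_law : ∀ n < H.T₂, ∀ k : Fin m, ∀ᵐ ω ∂μ,
    (μ[fun ω' => if (D ω').j (H.T₁ + n + 1) = k then (1 : ℝ) else 0 | F (H.T₁ + n)]) ω
      = 1 / (m : ℝ)

/-! ### The rates -/

/-- The rate for the number of first-phase iterations. -/
def rate₁ (m : ℕ) (γ lam Lg Gf Gg ε : ℝ) : ℝ :=
  m * (1 + Real.log m) ^ (2 / 3 : ℝ) * (Gf + γ * Gg + γ * Lg) ^ (4 / 3 : ℝ)
      / (lam ^ (4 / 3 : ℝ) * ε ^ (2 / 3 : ℝ))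
    + (m : ℝ) ^ 2 * (1 + Real.log m) * (Gf + γ * Gg) / (lam * √ε)

/-- The rate for the number of second-phase iterations. -/
def rate₂ (m : ℕ) (γ lam Lg Gf Gg ε : ℝ) : ℝ :=
  (1 + Real.log m) * (Gf + γ * Gg + γ * Lg) ^ 2 / (lam ^ 2 * ε)
    + (m : ℝ) ^ (3 / 2 : ℝ) * (1 + Real.log m) ^ (3 / 2 : ℝ) * (Gf + γ * Gg) ^ (3 / 2 : ℝ)
      / (lam ^ (3 / 2 : ℝ) * ε ^ (3 / 4 : ℝ))

/-- The rate for the number of constraint checks. -/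
def checkRate (m : ℕ) (γ lam Lg Gf Gg ε : ℝ) : ℝ :=
  (1 + Real.log m) * (Gf + γ * Gg + γ * Lg) ^ 2 / (lam ^ 2 * ε)
    + (m : ℝ) ^ (3 / 2 : ℝ) * (1 + Real.log m) ^ (3 / 2 : ℝ) * (Gf + γ * Gg) ^ (3 / 2 : ℝ)
      / (lam ^ (3 / 2 : ℝ) * ε ^ (3 / 4 : ℝ))
    + (m : ℝ) ^ 2 * (1 + Real.log m) ^ (2 / 3 : ℝ) * (Gf + γ * Gg + γ * Lg) ^ (4 / 3 : ℝ)
      / (lam ^ (4 / 3 : ℝ) * ε ^ (2 / 3 : ℝ))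
    + (m : ℝ) ^ 3 * (1 + Real.log m) * (Gf + γ * Gg) / (lam * √ε)

/-- The logarithmic quantity, free of `m`, a power of which the soft-O notation hides. -/
def logTerm (γ lam Lg Gf Gg ε : ℝ) : ℝ :=
  1 + Real.log (1 + (Gf + γ * Gg + γ * Lg) ^ 2 / (lam ^ 2 * ε))

end MidTouch

end

/-!
Exact penalization: since the subgradients of `g` on `{g = 0}` have norm at least `rho > Lf / γ`,
the point `w*` also minimizes `f + γ max {0, g}`. By minimax there are fixed weights `p*` with
`f + γ ∑ₖ p*ₖ max {0, gₖ} ≥ f w* + lam / 2 ‖w - w*‖²` on `W`, so `(w*, p*)` is a saddle point.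

The second phase is a game between projected subgradient steps for `w` and exponential weights for
`p`, and the growth above turns the sum of the two regrets into a bound on `‖w - w*‖²`. The
violations at `w` are at most `Lg ‖w - w*‖`, so the quadratic term in the regret of the weights is
a multiple of `η γ² Lg² ‖w - w*‖²`, which the choice of `η` absorbs into the growth. The remaining
term is the variance of the sampled violations around the remembered ones. It is small because a
value is refreshed every `m` iterations on average, while the first phase has made the steps
`1 / (lam t)`, hence the changes of the violations in the meantime, short.
-/

namespace MidTouch

section ConvexAnalysis

/-- A Lagrange multiplier for the single constraint `ψ`, which is strictly satisfied at `w`. -/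
theorem exists_multiplier_of_slater {E : Type*} [AddCommGroup E] [Module ℝ E] {S : Set E}
    {φ ψ : E → ℝ} (hφ : ConvexOn ℝ S φ) (hψ : ConcaveOn ℝ S ψ) {w : E} (hw : w ∈ S)
    (hψw : 0 < ψ w) (hpos : ∀ u ∈ S, 0 < ψ u → 0 ≤ φ u) :
    ∃ κ : ℝ, 0 ≤ κ ∧ ∀ u ∈ S, κ * ψ u ≤ φ u := by
  have cross : ∀ u ∈ S, ψ u ≤ 0 → ∀ v ∈ S, 0 < ψ v → ψ u * φ v ≤ ψ v * φ u := by
    intro u hu hψu v hv hψv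
    by_contra! hlt
    have hφv := hpos v hv hψv
    -- The convex combination with weights proportional to `ψ v` and `δ - ψ u` has `ψ > 0 > φ`.
    set δ := (ψ u * φ v - ψ v * φ u) / (φ v + 1)
    have hδ0 : 0 < δ := div_pos (by linarith) (by linarith)
    have hδφ : δ * (φ v + 1) = ψ u * φ v - ψ v * φ u := div_mul_cancel₀ _ (by positivity)
    have hsum : 0 < ψ v + (δ - ψ u) := by linarith
    have hψz := (concaveOn_iff_div.1 hψ).2 hu hv hψv.le (by linarith : 0 ≤ δ - ψ u) hsum
    have hφz := (convexOn_iff_div.1 hφ).2 hu hv hψv.le (by linarith : 0 ≤ δ - ψ u) hsum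
    have hz := convex_iff_div.1 hφ.1 hu hv hψv.le (by linarith : 0 ≤ δ - ψ u) hsum
    simp only [smul_eq_mul, div_mul_eq_mul_div, ← add_div] at hψz hφz
    refine (hpos _ hz (lt_of_lt_of_le (div_pos ?_ hsum) hψz)).not_gt
      (lt_of_le_of_lt hφz (div_neg_of_neg_of_pos ?_ hsum))
    · nlinarith
    · linarith
  obtain ⟨κ, hlower, hupper⟩ := exists_between_of_forall_le
    (s := insert 0 ((fun u => φ u / ψ u) '' {u ∈ S | ψ u < 0}))
    (t := (fun v => φ v / ψ v) '' {v ∈ S | 0 < ψ v}) (Set.insert_nonempty _ _)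
    ⟨_, w, ⟨hw, hψw⟩, rfl⟩ (by
      rintro _ (rfl | ⟨u, ⟨hu, hψu⟩, rfl⟩) _ ⟨v, ⟨hv, hψv⟩, rfl⟩
      · exact div_nonneg (hpos v hv hψv) hψv.le
      · rw [div_le_iff_of_neg hψu, div_mul_eq_mul_div, div_le_iff₀ hψv]
        linarith [cross u hu hψu.le v hv hψv])
  refine ⟨κ, hlower (Set.mem_insert _ _), fun u hu => ?_⟩
  rcases lt_trichotomy (ψ u) 0 with hψu | hψu | hψu
  · exact (div_le_iff_of_neg hψu).1 (hlower (Set.mem_insert_of_mem _ ⟨u, ⟨hu, hψu⟩, rfl⟩))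
  · have := cross u hu hψu.le w hw hψw
    rw [hψu, zero_mul] at this
    rw [hψu, mul_zero]
    exact nonneg_of_mul_nonneg_right this hψw
  · exact (le_div_iff₀ hψu).1 (hupper ⟨u, ⟨hu, hψu⟩, rfl⟩)

theorem continuousOn_of_abs_sub_le_mul_norm {E : Type*} [SeminormedAddCommGroup E] {S : Set E}
    {φ : E → ℝ} {L : ℝ} (h : ∀ x ∈ S, ∀ y ∈ S, |φ x - φ y| ≤ L * ‖x - y‖) :
    ContinuousOn φ S := by
  refine (LipschitzOnWith.of_dist_le_mul (K := L.toNNReal) fun x hx y hy => ?_).continuousOn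
  rw [Real.dist_eq, dist_eq_norm]
  exact (h x hx y hy).trans (mul_le_mul_of_nonneg_right (Real.le_coe_toNNReal L) (norm_nonneg _))

theorem norm_average_sub_sq_le {E : Type*} [SeminormedAddCommGroup E] [NormedSpace ℝ E]
    (x : ℕ → E) (y : E) {N : ℕ} (hN : 0 < N) :
    ‖(1 / (N : ℝ)) • ∑ n ∈ Finset.range N, x n - y‖ ^ 2
      ≤ 1 / (N : ℝ) * ∑ n ∈ Finset.range N, ‖x n - y‖ ^ 2 := by
  have hN' : (N : ℝ) ≠ 0 := by positivity
  have hconv : ConvexOn ℝ Set.univ fun z : E => ‖z - y‖ ^ 2 := by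
    simpa only [dist_eq_norm, Pi.pow_def] using
      (convexOn_univ_dist y).pow (fun _ _ => dist_nonneg) 2
  simpa only [← Finset.smul_sum, smul_eq_mul, ← Finset.mul_sum] using
    hconv.map_sum_le (t := Finset.range N) (w := fun _ => 1 / (N : ℝ)) (p := x)
      (fun _ _ => by positivity) (by simp [hN']) fun _ _ => Set.mem_univ _

theorem average_mem {E : Type*} [AddCommGroup E] [Module ℝ E] {S : Set E} (hS : Convex ℝ S)
    {x : ℕ → E} (hx : ∀ n, x n ∈ S) {N : ℕ} (hN : 0 < N) :
    (1 / (N : ℝ)) • ∑ n ∈ Finset.range N, x n ∈ S := by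
  have hN' : (N : ℝ) ≠ 0 := by positivity
  rw [Finset.smul_sum]
  exact hS.sum_mem (fun _ _ => by positivity) (by simp [hN']) fun n _ => hx n

variable {d : ℕ} {S : Set (Vec d)}

theorem IsSubgradient.add_modulus_le {f : Vec d → ℝ} {ψ : ℝ → ℝ} {x y v : Vec d}
    (hv : IsSubgradient S f x v) (hf : UniformConvexOn S ψ f) (hx : x ∈ S) (hy : y ∈ S) :
    f x + inner ℝ v (y - x) + ψ ‖x - y‖ ≤ f y := by
  have hsecant : ∀ s ∈ Set.Ioo (0 : ℝ) 1,
      f x + inner ℝ v (y - x) + (1 - s) * ψ ‖x - y‖ ≤ f y := by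
    rintro s ⟨hs0, hs1⟩
    have hsubgrad := hv _ (hf.1 hx hy (sub_nonneg.2 hs1.le) hs0.le (sub_add_cancel 1 s))
    have hconv := hf.2 hx hy (sub_nonneg.2 hs1.le) hs0.le (sub_add_cancel 1 s)
    rw [show (1 - s) • x + s • y - x = s • (y - x) by module, inner_smul_right] at hsubgrad
    simp only [smul_eq_mul] at hconv
    exact le_of_mul_le_mul_left (by linarith) hs0
  have hlim : Filter.Tendsto (fun s : ℝ => f x + inner ℝ v (y - x) + (1 - s) * ψ ‖x - y‖)
      (nhdsWithin 0 (Set.Ioi 0)) (nhds (f x + inner ℝ v (y - x) + (1 - 0) * ψ ‖x - y‖)) :=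
    (Continuous.tendsto (by fun_prop) 0).mono_left nhdsWithin_le_nhds
  have := le_of_tendsto hlim (Filter.mem_of_superset (Ioo_mem_nhdsGT zero_lt_one) hsecant)
  rwa [sub_zero, one_mul] at this

theorem IsSubgradient.add_sq_le {f : Vec d → ℝ} {lam : ℝ} {x y v : Vec d}
    (hv : IsSubgradient S f x v) (hf : StrongConvexOn S lam f) (hx : x ∈ S) (hy : y ∈ S) :
    f x + inner ℝ v (y - x) + lam / 2 * ‖x - y‖ ^ 2 ≤ f y :=
  hv.add_modulus_le hf hx hy

end ConvexAnalysis

section Projection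

variable {d : ℕ} {S : Set (Vec d)}

theorem isNearest_proj (hne : S.Nonempty) (hcl : IsClosed S) (x : Vec d) :
    proj S x ∈ S ∧ ∀ z ∈ S, ‖x - proj S x‖ ≤ ‖x - z‖ := by
  obtain ⟨y, hy, hxy⟩ := hcl.exists_infDist_eq_dist hne x
  refine Classical.epsilon_spec (p := fun y => y ∈ S ∧ ∀ z ∈ S, ‖x - y‖ ≤ ‖x - z‖)
    ⟨y, hy, fun z hz => ?_⟩
  simpa only [← dist_eq_norm, ← hxy] using Metric.infDist_le_dist_of_mem hz

theorem proj_mem (hne : S.Nonempty) (hcl : IsClosed S) (x : Vec d) : proj S x ∈ S :=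
  (isNearest_proj hne hcl x).1

theorem inner_sub_proj_nonpos (hne : S.Nonempty) (hcl : IsClosed S) (hcv : Convex ℝ S) (x : Vec d)
    {z : Vec d} (hz : z ∈ S) : inner ℝ (x - proj S x) (z - proj S x) ≤ 0 := by
  obtain ⟨hmem, hnear⟩ := isNearest_proj hne hcl x
  have : Nonempty S := hne.to_subtype
  refine (norm_eq_iInf_iff_real_inner_le_zero hcv hmem).1 (le_antisymm ?_ ?_) z hz
  · exact le_ciInf fun w => hnear w w.2
  · exact ciInf_le (f := fun w : S => ‖x - w‖) ⟨0, Set.forall_mem_range.2 fun _ => norm_nonneg _⟩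
      ⟨proj S x, hmem⟩

theorem norm_proj_sub_proj_le (hne : S.Nonempty) (hcl : IsClosed S) (hcv : Convex ℝ S)
    (x y : Vec d) : ‖proj S x - proj S y‖ ≤ ‖x - y‖ := by
  have hx := inner_sub_proj_nonpos hne hcl hcv x (proj_mem hne hcl y)
  have hy := inner_sub_proj_nonpos hne hcl hcv y (proj_mem hne hcl x)
  set a := proj S x
  set b := proj S y
  have hinner : ‖a - b‖ * ‖a - b‖ ≤ ‖x - y‖ * ‖a - b‖ := calc
    ‖a - b‖ * ‖a - b‖ = inner ℝ (x - y) (a - b) + inner ℝ (x - a) (b - a)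
        + inner ℝ (y - b) (a - b) := by
      rw [← real_inner_self_eq_norm_mul_norm, ← neg_sub a b, inner_neg_right, ← sub_eq_add_neg,
        ← inner_sub_left, ← inner_add_left]
      congr 1
      abel
    _ ≤ inner ℝ (x - y) (a - b) := by linarith
    _ ≤ ‖x - y‖ * ‖a - b‖ := real_inner_le_norm _ _
  rcases (norm_nonneg (a - b)).eq_or_lt with hab | hab
  · exact hab ▸ norm_nonneg _
  · exact le_of_mul_le_mul_right hinner hab

theorem continuous_proj (hne : S.Nonempty) (hcl : IsClosed S) (hcv : Convex ℝ S) :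
    Continuous (proj S) :=
  (LipschitzWith.of_dist_le_mul (K := 1) fun x y => by
    simpa [dist_eq_norm] using norm_proj_sub_proj_le hne hcl hcv x y).continuous

theorem proj_eq_self {x : Vec d} (hx : x ∈ S) : proj S x = x := by
  have hnear : ‖x - proj S x‖ ≤ ‖x - x‖ :=
    (Classical.epsilon_spec (p := fun y => y ∈ S ∧ ∀ z ∈ S, ‖x - y‖ ≤ ‖x - z‖)
      ⟨x, hx, fun z _ => by simp⟩).2 x hx
  rw [sub_self, norm_zero, norm_le_zero_iff, sub_eq_zero] at hnear
  exact hnear.symm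

theorem norm_proj_sub_le (hne : S.Nonempty) (hcl : IsClosed S) (hcv : Convex ℝ S)
    (x : Vec d) {y : Vec d} (hy : y ∈ S) : ‖proj S x - y‖ ≤ ‖x - y‖ := by
  simpa only [proj_eq_self hy] using norm_proj_sub_proj_le hne hcl hcv x y

/-- An error bound: if `w` is infeasible with projection `b`, then some nonnegative multiple of
`w - b` is a subgradient at `b`. -/
theorem mul_norm_sub_proj_sublevel_le {φ : Vec d → ℝ} {ρ : ℝ} (hφ : ConvexOn ℝ S φ)
    (hcl : IsClosed {u ∈ S | φ u ≤ 0}) (hne : {u ∈ S | φ u ≤ 0}.Nonempty)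
    (hρ : ∀ b ∈ S, φ b = 0 → ∀ v, IsSubgradient S φ b v → ρ ≤ ‖v‖) {w : Vec d} (hw : w ∈ S) :
    ρ * ‖w - proj {u ∈ S | φ u ≤ 0} w‖ ≤ max 0 (φ w) := by
  rcases le_or_gt (φ w) 0 with hφw | hφw
  · rw [proj_eq_self (S := {u ∈ S | φ u ≤ 0}) ⟨hw, hφw⟩, sub_self, norm_zero, mul_zero]
    exact le_max_left _ _
  have hobtuse := fun z => inner_sub_proj_nonpos (z := z) hne hcl (hφ.convex_le 0) w
  obtain ⟨hb, hφb⟩ := proj_mem hne hcl w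
  set b := proj {u ∈ S | φ u ≤ 0} w
  have hwb : 0 < ‖w - b‖ := norm_pos_iff.2 fun h => hφb.not_gt (sub_eq_zero.1 h ▸ hφw)
  have hinner : ConcaveOn ℝ S fun u => inner ℝ (w - b) (u - b) := by
    refine ⟨hφ.1, fun x _ y _ s t _ _ hst => le_of_eq ?_⟩
    simp only [inner_sub_right, inner_add_right, inner_smul_right, smul_eq_mul]
    linear_combination -inner ℝ (w - b) b * hst
  obtain ⟨κ, hκ, hmult⟩ := exists_multiplier_of_slater hφ hinner hw
    (by simpa only [real_inner_self_eq_norm_sq] using pow_pos hwb 2)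
    fun u hu hpos => le_of_not_gt fun hneg => (hobtuse u ⟨hu, hneg.le⟩).not_gt hpos
  have hb0 : φ b = 0 := le_antisymm hφb (by simpa using hmult b hb)
  have hsub : IsSubgradient S φ b (κ • (w - b)) := fun u hu => by
    simpa only [hb0, zero_add, real_inner_smul_left] using hmult u hu
  calc ρ * ‖w - b‖ ≤ ‖κ • (w - b)‖ * ‖w - b‖ :=
        mul_le_mul_of_nonneg_right (hρ b hb hb0 _ hsub) hwb.le
    _ = κ * inner ℝ (w - b) (w - b) := by
        rw [norm_smul, Real.norm_of_nonneg hκ, real_inner_self_eq_norm_mul_norm, mul_assoc]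
    _ ≤ φ w := hmult w hw
    _ ≤ max 0 (φ w) := le_max_right _ _

end Projection

section ExactPenalty

variable {d m : ℕ} {P : Problem d m}

/-- The violation `max {0, g_k}` of the `k`-th constraint. -/
noncomputable def Problem.violation (P : Problem d m) (k : Fin m) (w : Vec d) : ℝ :=
  max 0 (P.g k w)

/-- The objective penalized by `γ` times the average constraint violation under the weights `p`. -/
noncomputable def Problem.penalized (P : Problem d m) (γ : ℝ) (p : Fin m → ℝ) (w : Vec d) : ℝ :=
  P.f w + γ * ∑ k, p k * P.violation k w

theorem violation_nonneg (k : Fin m) (w : Vec d) : 0 ≤ P.violation k w := le_max_left _ _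

theorem violation_eq_zero {w : Vec d} (hw : w ∈ P.feasible) (k : Fin m) : P.violation k w = 0 :=
  max_eq_left (hw.2 k)

theorem le_gmax (i : Fin m) (w : Vec d) : P.g i w ≤ P.gmax w :=
  le_ciSup (f := fun i => P.g i w) (Set.finite_range _).bddAbove i

theorem penalized_eq_of_feasible {w : Vec d} (hw : w ∈ P.feasible) (γ : ℝ) (p : Fin m → ℝ) :
    P.penalized γ p w = P.f w := by
  simp [Problem.penalized, violation_eq_zero hw]

theorem penalized_single (γ : ℝ) (i : Fin m) (w : Vec d) :
    P.penalized γ (Pi.single i 1) w = P.f w + γ * P.violation i w := by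
  simp [Problem.penalized, Pi.single_apply]

theorem penalized_le_of_isMax {γ : ℝ} (hγ : 0 ≤ γ) {p : Fin m → ℝ}
    (hp : p ∈ stdSimplex ℝ (Fin m)) {w : Vec d} {i : Fin m} (hi : ∀ k, P.g k w ≤ P.g i w) :
    P.penalized γ p w ≤ P.f w + γ * P.violation i w := by
  refine add_le_add_right (mul_le_mul_of_nonneg_left ?_ hγ) _
  calc ∑ k, p k * P.violation k w ≤ ∑ k, p k * P.violation i w :=
        Finset.sum_le_sum fun k _ =>
          mul_le_mul_of_nonneg_left (max_le_max le_rfl (hi k)) (hp.1 k)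
    _ = P.violation i w := by rw [← Finset.sum_mul, hp.2, one_mul]

theorem concaveOn_penalized_weights (γ : ℝ) (w : Vec d) :
    ConcaveOn ℝ (stdSimplex ℝ (Fin m)) fun p => P.penalized γ p w := by
  refine ⟨convex_stdSimplex ℝ _, fun p _ q _ a b _ _ hab => le_of_eq ?_⟩
  simp only [Problem.penalized, smul_eq_mul, Pi.add_apply, Pi.smul_apply, add_mul,
    Finset.sum_add_distrib, mul_assoc, ← Finset.mul_sum]
  linear_combination P.f w * hab

theorem continuous_penalized_weights (γ : ℝ) (w : Vec d) :
    Continuous fun p => P.penalized γ p w := by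
  unfold Problem.penalized
  fun_prop

section Admissible

variable {lam Lf Lg rho γ : ℝ} (hP : P.Admissible lam Lf Lg rho)
include hP

theorem abs_violation_sub_le (k : Fin m) {w w' : Vec d} (hw : w ∈ P.W) (hw' : w' ∈ P.W) :
    |P.violation k w - P.violation k w'| ≤ Lg * ‖w - w'‖ := by
  refine le_trans ?_ (hP.lipschitz_g k w hw w' hw')
  simpa only [Problem.violation, max_comm] using abs_max_sub_max_le_abs (P.g k w) (P.g k w') 0

theorem violation_le {w u : Vec d} (hw : w ∈ P.W) (hu : u ∈ P.feasible) (k : Fin m) :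
    P.violation k w ≤ Lg * ‖w - u‖ := by
  simpa only [violation_eq_zero hu, sub_zero] using
    (le_abs_self _).trans (abs_violation_sub_le hP k hw hu.1)

theorem continuousOn_f : ContinuousOn P.f P.W :=
  continuousOn_of_abs_sub_le_mul_norm hP.lipschitz_f

theorem continuousOn_violation (k : Fin m) : ContinuousOn (P.violation k) P.W :=
  continuousOn_of_abs_sub_le_mul_norm fun _ hw _ hw' => abs_violation_sub_le hP k hw hw'

theorem continuousOn_penalized (p : Fin m → ℝ) : ContinuousOn (P.penalized γ p) P.W :=
  (continuousOn_f hP).add (continuousOn_const.mul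
    (continuousOn_finsetSum _ fun k _ => continuousOn_const.mul (continuousOn_violation hP k)))

theorem convexOn_violation (k : Fin m) : ConvexOn ℝ P.W (P.violation k) :=
  (convexOn_const 0 hP.convex).sup (hP.convex_g k)

theorem strongConvexOn_penalized (hγ : 0 ≤ γ) {p : Fin m → ℝ} (hp : ∀ k, 0 ≤ p k) :
    StrongConvexOn P.W lam (P.penalized γ p) := by
  have hpenalty : ConvexOn ℝ P.W fun w => γ * ∑ k, p k * P.violation k w := by
    refine ConvexOn.smul hγ ?_
    simpa only [Finset.sum_fn] using Finset.univ.sum_induction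
      (fun k w => p k * P.violation k w) (ConvexOn ℝ P.W) (fun _ _ => ConvexOn.add)
      (convexOn_const 0 hP.convex) fun k _ => (convexOn_violation hP k).smul (hp k)
  simpa using! hP.strongConvex.add (uniformConvexOn_zero.2 hpenalty)

variable [Nonempty (Fin m)]

omit hP in
theorem feasible_eq_sublevel : P.feasible = {w ∈ P.W | P.gmax w ≤ 0} := by
  ext w
  exact and_congr_right fun _ => (ciSup_le_iff (Set.finite_range _).bddAbove).symm

theorem convexOn_gmax : ConvexOn ℝ P.W P.gmax := by
  refine ⟨hP.convex, fun x hx y hy a b ha hb hab => ciSup_le fun i => ?_⟩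
  exact ((hP.convex_g i).2 hx hy ha hb hab).trans (add_le_add
    (smul_le_smul_of_nonneg_left (le_gmax i x) ha) (smul_le_smul_of_nonneg_left (le_gmax i y) hb))

theorem continuousOn_gmax : ContinuousOn P.gmax P.W := by
  have hsup : P.gmax = fun w => Finset.univ.sup' Finset.univ_nonempty fun i => P.g i w :=
    funext fun w => (Finset.sup'_univ_eq_ciSup _).symm
  rw [hsup]
  exact ContinuousOn.finset_sup'_apply _ fun i _ =>
    continuousOn_of_abs_sub_le_mul_norm (hP.lipschitz_g i)

theorem isClosed_feasible : IsClosed P.feasible := by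
  rw [feasible_eq_sublevel]
  exact (continuousOn_gmax hP).preimage_isClosed_of_isClosed hP.closed isClosed_Iic

theorem convex_feasible : Convex ℝ P.feasible := by
  rw [feasible_eq_sublevel]
  exact (convexOn_gmax hP).convex_le 0

variable {wstar : Vec d}

/-- Exact penalization: `f` grows by at most `Lf ‖w - b‖` between `w` and its projection `b`, which
the error bound charges to the violation. -/
theorem le_add_mul_max_gmax (hγ : Lf / rho ≤ γ) (hγ0 : 0 ≤ γ) (hopt : P.IsOptimum wstar)
    {w : Vec d} (hw : w ∈ P.W) : P.f wstar ≤ P.f w + γ * max 0 (P.gmax w) := by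
  have hb := proj_mem ⟨_, hopt.1⟩ (isClosed_feasible hP) w
  have hbound : rho * ‖w - proj P.feasible w‖ ≤ max 0 (P.gmax w) := by
    have hcl := isClosed_feasible hP
    have hne : P.feasible.Nonempty := ⟨_, hopt.1⟩
    rw [feasible_eq_sublevel] at hcl hne ⊢
    exact mul_norm_sub_proj_sublevel_le (convexOn_gmax hP) hcl hne hP.boundary hw
  calc P.f wstar ≤ P.f (proj P.feasible w) := hopt.2 _ hb
    _ ≤ P.f w + Lf * ‖w - proj P.feasible w‖ := by
        linarith [(abs_le.1 (hP.lipschitz_f w hw _ hb.1)).1]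
    _ ≤ P.f w + γ * rho * ‖w - proj P.feasible w‖ := by
        gcongr
        exact (div_le_iff₀ hP.rho_pos).1 hγ
    _ ≤ P.f w + γ * max 0 (P.gmax w) := by
        rw [mul_assoc]
        gcongr

theorem exists_isSaddlePointOn_penalized (hγ : 0 ≤ γ) (hlam : 0 ≤ lam) (hne : P.W.Nonempty) :
    ∃ a ∈ P.W, ∃ p ∈ stdSimplex ℝ (Fin m),
      IsSaddlePointOn P.W (stdSimplex ℝ (Fin m)) (fun w q => P.penalized γ q w) a p :=
  Sion.exists_isSaddlePointOn hne hP.convex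
    (Metric.isCompact_of_isClosed_isBounded hP.closed hP.bounded)
    (fun p _ => (continuousOn_penalized hP p).lowerSemicontinuousOn)
    (fun _ hp => (strongConvexOn_zero.1
      ((strongConvexOn_penalized hP hγ hp.1).mono hlam)).quasiconvexOn)
    (convex_stdSimplex ℝ _) ⟨_, single_mem_stdSimplex ℝ (Classical.arbitrary (Fin m))⟩
    (isCompact_stdSimplex ℝ _)
    (fun w _ => (continuous_penalized_weights γ w).continuousOn.upperSemicontinuousOn)
    (fun w _ => (concaveOn_penalized_weights γ w).quasiconcaveOn)

theorem exists_weights_penalized_growth (hγ : Lf / rho ≤ γ) (hγ0 : 0 ≤ γ) (hlam : 0 ≤ lam)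
    (hopt : P.IsOptimum wstar) :
    ∃ p ∈ stdSimplex ℝ (Fin m), ∀ w ∈ P.W,
      P.f wstar + lam / 2 * ‖w - wstar‖ ^ 2 ≤ P.penalized γ p w := by
  obtain ⟨a, ha, p, hp, hsaddle⟩ :=
    exists_isSaddlePointOn_penalized hP hγ0 hlam ⟨wstar, hopt.1.1⟩
  have hmin : IsSubgradient P.W (P.penalized γ p) wstar 0 := by
    intro u hu
    obtain ⟨i, hi⟩ : ∃ i, P.g i a = P.gmax a := exists_eq_ciSup_of_finite
    rw [inner_zero_left, add_zero, penalized_eq_of_feasible hopt.1]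
    calc P.f wstar ≤ P.f a + γ * max 0 (P.gmax a) := le_add_mul_max_gmax hP hγ hγ0 hopt ha
      _ = P.penalized γ (Pi.single i 1) a := by rw [penalized_single, Problem.violation, hi]
      _ ≤ P.penalized γ p u := hsaddle u hu _ (single_mem_stdSimplex ℝ i)
  refine ⟨p, hp, fun w hw => ?_⟩
  have hgrowth := hmin.add_sq_le (strongConvexOn_penalized hP hγ0 hp.1) hopt.1.1 hw
  rwa [inner_zero_left, add_zero, penalized_eq_of_feasible hopt.1, norm_sub_rev] at hgrowth

end Admissible

end ExactPenalty

section ExponentialWeights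

variable {ι : Type*} [Fintype ι]

theorem sum_mul_exp_le {p x : ι → ℝ} {a b : ℝ} (hp : p ∈ stdSimplex ℝ ι)
    (hx : ∀ k, x k ∈ Set.Icc a b) :
    ∑ k, p k * Real.exp (x k) ≤ Real.exp (∑ k, p k * x k + (b - a) ^ 2 / 8) := by
  let _ : MeasurableSpace ι := ⊤
  have hsum : ∑ k, ENNReal.ofReal (p k) = 1 := by
    rw [← ENNReal.ofReal_sum_of_nonneg fun k _ => hp.1 k, hp.2, ENNReal.ofReal_one]
  let μ : Measure ι := (PMF.ofFintype (fun k => ENNReal.ofReal (p k)) hsum).toMeasure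
  have hμ (φ : ι → ℝ) : ∫ k, φ k ∂μ = ∑ k, p k * φ k := by
    rw [PMF.integral_eq_sum]
    simp only [PMF.ofFintype_apply, ENNReal.toReal_ofReal (hp.1 _), smul_eq_mul]
  have hoeffding := (ProbabilityTheory.hasSubgaussianMGF_of_mem_Icc (μ := μ)
    (measurable_of_finite x).aemeasurable (ae_of_all _ hx)).mgf_le 1
  rw [ProbabilityTheory.mgf, hμ, hμ] at hoeffding
  calc ∑ k, p k * Real.exp (x k)
      = Real.exp (∑ k, p k * x k) * ∑ k, p k * Real.exp (1 * (x k - ∑ k, p k * x k)) := by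
        rw [Finset.mul_sum]
        refine Finset.sum_congr rfl fun k _ => ?_
        rw [mul_left_comm, ← Real.exp_add, one_mul, add_sub_cancel]
    _ ≤ Real.exp (∑ k, p k * x k) * Real.exp ((b - a) ^ 2 / 8) := by
        refine mul_le_mul_of_nonneg_left (hoeffding.trans_eq ?_) (Real.exp_pos _).le
        push_cast
        rw [Real.norm_eq_abs, div_pow, sq_abs]
        ring_nf
    _ = Real.exp (∑ k, p k * x k + (b - a) ^ 2 / 8) := (Real.exp_add _ _).symm

/-- The cross entropy of `p` relative to `q`, the potential in the regret analysis of the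
exponential weights update. -/
noncomputable def crossEntropy (q p : ι → ℝ) : ℝ := -∑ k, q k * Real.log (p k)

theorem crossEntropy_nonneg {q p : ι → ℝ} (hq : ∀ k, 0 ≤ q k) (hp : p ∈ stdSimplex ℝ ι) :
    0 ≤ crossEntropy q p := by
  rw [crossEntropy, Left.nonneg_neg_iff]
  exact Finset.sum_nonpos fun k _ => mul_nonpos_of_nonneg_of_nonpos (hq k)
    (Real.log_nonpos (hp.1 k) (mem_Icc_of_mem_stdSimplex hp k).2)

/-- The exponential weights update of the distribution `p` along `s`. -/
noncomputable def expWeights (p s : ι → ℝ) (k : ι) : ℝ :=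
  p k * Real.exp (s k) / ∑ l, p l * Real.exp (s l)

variable [Nonempty ι] {p : ι → ℝ}

theorem sum_mul_exp_pos (hp : ∀ k, 0 < p k) (s : ι → ℝ) : 0 < ∑ l, p l * Real.exp (s l) :=
  Finset.sum_pos (fun l _ => mul_pos (hp l) (Real.exp_pos _)) Finset.univ_nonempty

theorem expWeights_pos (hp : ∀ k, 0 < p k) (s : ι → ℝ) (k : ι) : 0 < expWeights p s k :=
  div_pos (mul_pos (hp k) (Real.exp_pos _)) (sum_mul_exp_pos hp s)

theorem sum_expWeights (hp : ∀ k, 0 < p k) (s : ι → ℝ) : ∑ k, expWeights p s k = 1 := by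
  simp only [expWeights]
  rw [← Finset.sum_div, div_self (sum_mul_exp_pos hp s).ne']

theorem log_expWeights (hp : ∀ k, 0 < p k) (s : ι → ℝ) (k : ι) :
    Real.log (expWeights p s k)
      = Real.log (p k) + s k - Real.log (∑ l, p l * Real.exp (s l)) := by
  rw [expWeights,
    Real.log_div (mul_pos (hp k) (Real.exp_pos _)).ne' (sum_mul_exp_pos hp s).ne',
    Real.log_mul (hp k).ne' (Real.exp_ne_zero _), Real.log_exp]

theorem crossEntropy_expWeights {q : ι → ℝ} (hq : ∑ k, q k = 1) (hp : ∀ k, 0 < p k)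
    (s : ι → ℝ) :
    crossEntropy q (expWeights p s)
      = crossEntropy q p - ∑ k, q k * s k + Real.log (∑ l, p l * Real.exp (s l)) := by
  simp only [crossEntropy, log_expWeights hp, mul_sub, mul_add, Finset.sum_sub_distrib,
    Finset.sum_add_distrib, ← Finset.sum_mul, hq]
  ring

theorem regret_expWeights_le {q s : ι → ℝ} {a b : ℝ} (hq : ∑ k, q k = 1) (hp : ∀ k, 0 < p k)
    (hp1 : ∑ k, p k = 1) (hs : ∀ k, s k ∈ Set.Icc a b) :
    ∑ k, (q k - p k) * s k
      ≤ crossEntropy q p - crossEntropy q (expWeights p s) + (b - a) ^ 2 / 8 := by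
  have hoeffding : Real.log (∑ l, p l * Real.exp (s l)) ≤ ∑ k, p k * s k + (b - a) ^ 2 / 8 :=
    (Real.log_le_iff_le_exp (sum_mul_exp_pos hp s)).2
      (sum_mul_exp_le ⟨fun k => (hp k).le, hp1⟩ hs)
  simp only [sub_mul, Finset.sum_sub_distrib]
  rw [crossEntropy_expWeights hq hp]
  linarith

end ExponentialWeights

section WeightUpdate

variable {m : ℕ} {H : Hyper} {p : Fin m → ℝ}

theorem pUpdate_eq_expWeights (hp : ∀ k, 0 < p k) (s : Fin m → ℝ) :
    pUpdate H p s = expWeights p (H.η • s) := by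
  funext k
  simp only [pUpdate, expWeights, Real.abs_exp]
  simp only [Real.exp_add, Real.exp_log (hp _), Pi.smul_apply, smul_eq_mul]

/-- The error in the remembered values moves the supergradient out of the range `[0, γ B]` of the
scaled constraint values by at most `γ` times this quantity. -/
theorem pGradient_mem_Icc {mu x : Fin m → ℝ} {B : ℝ} (hγ : 0 ≤ H.γ)
    (hx : ∀ k, x k ∈ Set.Icc 0 B) (j k : Fin m) :
    pGradient H mu j (x j) k ∈ Set.Icc
      (-(H.γ * (√(∑ l, (x l - mu l) ^ 2) + m * |x j - mu j|)))
      (H.γ * (B + (√(∑ l, (x l - mu l) ^ 2) + m * |x j - mu j|))) := by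
  have hmu : |x k - mu k| ≤ √(∑ l, (x l - mu l) ^ 2) := Real.abs_le_sqrt
    (Finset.single_le_sum (f := fun l => (x l - mu l) ^ 2) (fun l _ => sq_nonneg _)
      (Finset.mem_univ k))
  have hjump : |if k = j then (m : ℝ) * (x j - mu j) else 0| ≤ m * |x j - mu j| := by
    split_ifs
    · rw [abs_mul, Nat.abs_cast]
    · rw [abs_zero]
      positivity
  have hfactor : pGradient H mu j (x j) k
      = H.γ * (mu k + if k = j then (m : ℝ) * (x j - mu j) else 0) := by
    rw [pGradient, mul_add, mul_ite, mul_zero, ← mul_assoc]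
  obtain ⟨h0, hB⟩ := hx k
  rw [hfactor, ← mul_neg]
  constructor <;> refine mul_le_mul_of_nonneg_left ?_ hγ <;>
    linarith [abs_le.1 hmu, abs_le.1 hjump]

theorem regret_pUpdate_le [Nonempty (Fin m)] {q mu x : Fin m → ℝ} {B : ℝ} (hq : ∑ k, q k = 1)
    (hp : ∀ k, 0 < p k) (hp1 : ∑ k, p k = 1) (hη : 0 < H.η) (hγ : 0 ≤ H.γ)
    (hx : ∀ k, x k ∈ Set.Icc 0 B) (j : Fin m) :
    ∑ k, (q k - p k) * pGradient H mu j (x j) k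
      ≤ (crossEntropy q p - crossEntropy q (pUpdate H p (pGradient H mu j (x j)))) / H.η
        + H.η * H.γ ^ 2 * (B ^ 2 / 4
          + 2 * (∑ k, (x k - mu k) ^ 2 + m ^ 2 * (x j - mu j) ^ 2)) := by
  set r := √(∑ k, (x k - mu k) ^ 2)
  have hr : r ^ 2 = ∑ k, (x k - mu k) ^ 2 :=
    Real.sq_sqrt (Finset.sum_nonneg fun k _ => sq_nonneg _)
  set e := m * |x j - mu j|
  have he : e ^ 2 = m ^ 2 * (x j - mu j) ^ 2 := by rw [mul_pow, sq_abs]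
  have hrange (k : Fin m) : (H.η • pGradient H mu j (x j)) k ∈
      Set.Icc (H.η * -(H.γ * (r + e))) (H.η * (H.γ * (B + (r + e)))) := by
    obtain ⟨hl, hu⟩ := pGradient_mem_Icc hγ hx j k
    exact ⟨mul_le_mul_of_nonneg_left hl hη.le, mul_le_mul_of_nonneg_left hu hη.le⟩
  have hwidth : (B + 2 * (r + e)) ^ 2 / 8 ≤ B ^ 2 / 4 + 2 * (r ^ 2 + e ^ 2) := by
    nlinarith [sq_nonneg (B - 2 * (r + e)), sq_nonneg (r - e)]
  have hregret := regret_expWeights_le hq hp hp1 hrange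
  rw [← pUpdate_eq_expWeights hp] at hregret
  calc ∑ k, (q k - p k) * pGradient H mu j (x j) k
      = (∑ k, (q k - p k) * (H.η • pGradient H mu j (x j)) k) / H.η := by
        simp only [Pi.smul_apply, smul_eq_mul, mul_left_comm _ H.η, ← Finset.mul_sum]
        rw [mul_div_cancel_left₀ _ hη.ne']
    _ ≤ (crossEntropy q p - crossEntropy q (pUpdate H p (pGradient H mu j (x j)))
          + (H.η * (H.γ * (B + (r + e))) - H.η * -(H.γ * (r + e))) ^ 2 / 8) / H.η := by gcongr
    _ = (crossEntropy q p - crossEntropy q (pUpdate H p (pGradient H mu j (x j)))) / H.η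
          + H.η * H.γ ^ 2 * ((B + 2 * (r + e)) ^ 2 / 8) := by
        field_simp
        ring
    _ ≤ _ := by
        rw [← hr, ← he]
        gcongr

end WeightUpdate

section ProjectedSubgradient

variable {d : ℕ} {S : Set (Vec d)} {w z : Vec d}

theorem norm_proj_sub_smul_sub_sq_le (hcl : IsClosed S) (hcv : Convex ℝ S) (hz : z ∈ S)
    (w v : Vec d) (s : ℝ) :
    ‖proj S (w - s • v) - z‖ ^ 2
      ≤ ‖w - z‖ ^ 2 - 2 * s * inner ℝ v (w - z) + s ^ 2 * ‖v‖ ^ 2 := by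
  refine (pow_le_pow_left₀ (norm_nonneg _)
    (norm_proj_sub_le ⟨z, hz⟩ hcl hcv (w - s • v) hz) 2).trans_eq ?_
  rw [sub_right_comm, norm_sub_sq_real, inner_smul_right, norm_smul, mul_pow, Real.norm_eq_abs,
    sq_abs, real_inner_comm]
  ring

theorem norm_proj_sub_smul_sub_le (hcl : IsClosed S) (hcv : Convex ℝ S) (hw : w ∈ S)
    (v : Vec d) (s : ℝ) : ‖proj S (w - s • v) - w‖ ≤ |s| * ‖v‖ := by
  refine (norm_proj_sub_le ⟨w, hw⟩ hcl hcv (w - s • v) hw).trans_eq ?_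
  rw [sub_sub_cancel_left, norm_neg, norm_smul, Real.norm_eq_abs]

theorem inner_sub_mul_sq_le_sub_add {lam G t : ℝ} {v : Vec d} (hlam : 0 < lam)
    (ht : 0 < t) (hcl : IsClosed S) (hcv : Convex ℝ S) (hz : z ∈ S) (hv : ‖v‖ ≤ G) :
    inner ℝ v (w - z) - lam / 2 * ‖w - z‖ ^ 2
      ≤ lam / 2 * (t - 1) * ‖w - z‖ ^ 2
        - lam / 2 * t * ‖proj S (w - (1 / (lam * t)) • v) - z‖ ^ 2
        + G ^ 2 / (2 * lam) * (1 / t) := by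
  have hstep := norm_proj_sub_smul_sub_sq_le hcl hcv hz w v (1 / (lam * t))
  have hvG : ‖v‖ ^ 2 ≤ G ^ 2 := pow_le_pow_left₀ (norm_nonneg _) hv 2
  have hscaled : lam / 2 * t * ‖proj S (w - (1 / (lam * t)) • v) - z‖ ^ 2
      ≤ lam / 2 * t * (‖w - z‖ ^ 2 - 2 * (1 / (lam * t)) * inner ℝ v (w - z)
        + (1 / (lam * t)) ^ 2 * G ^ 2) := by
    refine mul_le_mul_of_nonneg_left (hstep.trans ?_) (by positivity)
    gcongr
  have hexpand : lam / 2 * t * (‖w - z‖ ^ 2 - 2 * (1 / (lam * t)) * inner ℝ v (w - z)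
        + (1 / (lam * t)) ^ 2 * G ^ 2)
      = lam / 2 * t * ‖w - z‖ ^ 2 - inner ℝ v (w - z) + G ^ 2 / (2 * lam) * (1 / t) := by
    field_simp
  linarith

/-- The steps `1 / (lam t)` make the sum telescope: strong convexity pays for the difference
between the weights `lam (t - 1) / 2` and `lam t / 2` of consecutive squared distances. -/
theorem sum_inner_sub_mul_sq_le {lam G : ℝ} {T N : ℕ} {x v : ℕ → Vec d} (hlam : 0 < lam)
    (hcl : IsClosed S) (hcv : Convex ℝ S) (hz : z ∈ S)
    (hx : ∀ n < N, x (n + 1) = proj S (x n - (1 / (lam * ((T + n + 1 : ℕ) : ℝ))) • v n))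
    (hv : ∀ n < N, ‖v n‖ ≤ G) :
    ∑ n ∈ Finset.range N, (inner ℝ (v n) (x n - z) - lam / 2 * ‖x n - z‖ ^ 2)
      ≤ lam / 2 * T * ‖x 0 - z‖ ^ 2
        + G ^ 2 / (2 * lam) * ∑ n ∈ Finset.range N, 1 / ((T + n + 1 : ℕ) : ℝ) := by
  set potential : ℕ → ℝ := fun n => lam / 2 * (T + n : ℕ) * ‖x n - z‖ ^ 2
  have hstep (n : ℕ) (hn : n ∈ Finset.range N) :
      inner ℝ (v n) (x n - z) - lam / 2 * ‖x n - z‖ ^ 2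
        ≤ potential n - potential (n + 1) + G ^ 2 / (2 * lam) * (1 / ((T + n + 1 : ℕ) : ℝ)) := by
    have hn := Finset.mem_range.1 hn
    simp only [potential, hx n hn, ← add_assoc]
    have ht : ((T + n + 1 : ℕ) : ℝ) - 1 = (T + n : ℕ) := by push_cast; ring
    rw [← ht]
    exact inner_sub_mul_sq_le_sub_add hlam (by positivity) hcl hcv hz (hv n hn)
  have hsum := Finset.sum_le_sum hstep
  rw [Finset.sum_add_distrib, Finset.sum_range_sub', ← Finset.mul_sum] at hsum
  have hlast : 0 ≤ potential N := by positivity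
  have hfirst : potential 0 = lam / 2 * T * ‖x 0 - z‖ ^ 2 := by simp only [potential, add_zero]
  linarith

end ProjectedSubgradient

section Checks

@[simp]
theorem Counted.checks_pure {α : Type} (a : α) : (pure a : Counted α).checks = 0 := rfl

@[simp]
theorem Counted.checks_bind {α β : Type} (c : Counted α) (k : α → Counted β) :
    (c >>= k).checks = c.checks + (k c.val).checks := rfl

variable {d m : ℕ} {P : Problem d m} {O : Oracle d m} {H : Hyper} {D : Draws d m}

theorem checks_firstPhase (n : ℕ) : (firstPhase P O H D n).checks = n * (m + 1) := by
  induction n with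
  | zero => simp only [firstPhase, Counted.checks_pure, zero_mul]
  | succ n ih =>
    simp only [firstPhase, Counted.checks_bind, Counted.checks_pure, Counted.all, evalConstraint,
      diffConstraint, ih, Finset.sum_const, Finset.card_univ, Fintype.card_fin, smul_eq_mul]
    ring

theorem checks_secondPhase (n : ℕ) :
    (secondPhase P O H D n).checks = H.T₁ * (m + 1) + m + 2 * n := by
  induction n with
  | zero =>
    simp only [secondPhase, Counted.checks_bind, Counted.checks_pure, Counted.all, evalConstraint,
      checks_firstPhase, Finset.sum_const, Finset.card_univ, Fintype.card_fin, smul_eq_mul]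
    ring
  | succ n ih =>
    simp only [secondPhase, secondStep, Counted.checks_bind, Counted.checks_pure, evalConstraint,
      diffConstraint, ih]
    ring

theorem totalChecks_eq : totalChecks P O H D = H.T₁ * (m + 1) + m + 2 * H.T₂ :=
  checks_secondPhase _

end Checks

section Trajectory

variable {d m : ℕ}

/-- The subgradient of the penalized objective used in the first phase at `w^(n+1)`. -/
noncomputable def firstDir (P : Problem d m) (O : Oracle d m) (H : Hyper) (D : Draws d m)
    (n : ℕ) : Vec d :=
  D.sg (n + 1) + H.γ •
    O.grad (O.sel fun i => P.g i (firstPhase P O H D n).val) (firstPhase P O H D n).val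

/-- The subgradient of the penalized objective used in the second phase at `w^(T₁+n+1)`. -/
noncomputable def secondDir (P : Problem d m) (O : Oracle d m) (H : Hyper) (D : Draws d m)
    (n : ℕ) : Vec d :=
  D.sg (H.T₁ + n + 1) + H.γ • O.grad (D.i (H.T₁ + n + 1)) (secondPhase P O H D n).val.w

/-- The linearized regret of the weights `p^(T₁+n+1)` against `q`, along the stochastic
supergradient of that iteration. -/
noncomputable def weightRegret (P : Problem d m) (O : Oracle d m) (H : Hyper) (D : Draws d m)
    (q : Fin m → ℝ) (n : ℕ) : ℝ :=
  ∑ k, (q k - (secondPhase P O H D n).val.p k)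
    * pGradient H (secondPhase P O H D n).val.mu (D.j (H.T₁ + n + 1))
      (P.violation (D.j (H.T₁ + n + 1)) (secondPhase P O H D n).val.w) k

/-- The error of the remembered value of the `k`-th violation in iteration `T₁ + n + 1`. -/
noncomputable def memErr (P : Problem d m) (O : Oracle d m) (H : Hyper) (D : Draws d m)
    (n : ℕ) (k : Fin m) : ℝ :=
  P.violation k (secondPhase P O H D n).val.w - (secondPhase P O H D n).val.mu k

/-- The memory errors, squared and weighted as they enter the regret bound for the weights: the
sampled one is amplified by `m`. -/
noncomputable def memCost (P : Problem d m) (O : Oracle d m) (H : Hyper) (D : Draws d m)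
    (n : ℕ) : ℝ :=
  ∑ k, memErr P O H D n k ^ 2 + m ^ 2 * memErr P O H D n (D.j (H.T₁ + n + 1)) ^ 2

variable {P : Problem d m} {O : Oracle d m} {H : Hyper} {D : Draws d m}

theorem firstPhase_succ (n : ℕ) :
    (firstPhase P O H D (n + 1)).val = proj P.W ((firstPhase P O H D n).val
      - (1 / (H.lam * ((n + 1 : ℕ) : ℝ))) • firstDir P O H D n) := rfl

theorem secondPhase_zero_p : (secondPhase P O H D 0).val.p = fun _ => 1 / (m : ℝ) := rfl

theorem secondPhase_succ_w (n : ℕ) :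
    (secondPhase P O H D (n + 1)).val.w = proj P.W ((secondPhase P O H D n).val.w
      - (1 / (H.lam * ((H.T₁ + n + 1 : ℕ) : ℝ))) • secondDir P O H D n) := rfl

theorem secondPhase_succ_p (n : ℕ) : (secondPhase P O H D (n + 1)).val.p =
    pUpdate H (secondPhase P O H D n).val.p
      (pGradient H (secondPhase P O H D n).val.mu (D.j (H.T₁ + n + 1))
        (P.violation (D.j (H.T₁ + n + 1)) (secondPhase P O H D n).val.w)) := rfl

theorem secondPhase_succ_mu (n : ℕ) (k : Fin m) :
    (secondPhase P O H D (n + 1)).val.mu k =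
      if D.j (H.T₁ + n + 1) = k then P.violation k (secondPhase P O H D n).val.w
      else (secondPhase P O H D n).val.mu k := by
  change Function.update (secondPhase P O H D n).val.mu (D.j (H.T₁ + n + 1))
    (P.violation (D.j (H.T₁ + n + 1)) (secondPhase P O H D n).val.w) k = _
  obtain rfl | h := eq_or_ne (D.j (H.T₁ + n + 1)) k
  · rw [Function.update_self, if_pos rfl]
  · rw [Function.update_of_ne h.symm, if_neg h]

variable {lam Lf Lg rho Gf Gg : ℝ} {z : Vec d}

section Membership

variable (hP : P.Admissible lam Lf Lg rho) (h0 : D.w₁ ∈ P.W)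
include hP h0

theorem firstPhase_mem (n : ℕ) : (firstPhase P O H D n).val ∈ P.W := by
  cases n with
  | zero => exact h0
  | succ n => exact proj_mem ⟨_, h0⟩ hP.closed _

variable (hT : 0 < H.T₁)
include hT

theorem firstAverage_mem : firstAverage P O H D ∈ P.W :=
  average_mem hP.convex (firstPhase_mem hP h0) hT

theorem secondPhase_w_mem (n : ℕ) : (secondPhase P O H D n).val.w ∈ P.W := by
  cases n with
  | zero => exact firstAverage_mem hP h0 hT
  | succ n => exact proj_mem ⟨_, h0⟩ hP.closed _

theorem secondPhase_mu_mem {c : ℝ} (hc : ∀ k, ∀ w ∈ P.W, P.violation k w ≤ c) (n : ℕ)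
    (k : Fin m) : (secondPhase P O H D n).val.mu k ∈ Set.Icc 0 c := by
  induction n with
  | zero => exact ⟨violation_nonneg _ _, hc _ _ (firstAverage_mem hP h0 hT)⟩
  | succ n ih =>
    rw [secondPhase_succ_mu]
    split_ifs
    · exact ⟨violation_nonneg _ _, hc _ _ (secondPhase_w_mem hP h0 hT n)⟩
    · exact ih

theorem average_secondPhase_mem (hT₂ : 0 < H.T₂) : average P O H D ∈ P.W :=
  average_mem hP.convex (secondPhase_w_mem hP h0 hT) hT₂

end Membership

section Weights

variable [Nonempty (Fin m)]

theorem secondPhase_p_pos (n : ℕ) (k : Fin m) : 0 < (secondPhase P O H D n).val.p k := by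
  induction n generalizing k with
  | zero =>
    have : 0 < m := Fin.pos_iff_nonempty.2 ‹_›
    rw [secondPhase_zero_p]
    positivity
  | succ n ih =>
    rw [secondPhase_succ_p, pUpdate_eq_expWeights ih]
    exact expWeights_pos ih _ _

theorem secondPhase_p_mem_stdSimplex (n : ℕ) :
    (secondPhase P O H D n).val.p ∈ stdSimplex ℝ (Fin m) := by
  refine ⟨fun k => (secondPhase_p_pos n k).le, ?_⟩
  cases n with
  | zero =>
    have : (m : ℝ) ≠ 0 := Nat.cast_ne_zero.2 (Fin.pos_iff_nonempty.2 ‹_›).ne'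
    simp [secondPhase_zero_p, this]
  | succ n =>
    rw [secondPhase_succ_p, pUpdate_eq_expWeights (secondPhase_p_pos n)]
    exact sum_expWeights (secondPhase_p_pos n) _

omit [Nonempty (Fin m)] in
theorem crossEntropy_secondPhase_zero {q : Fin m → ℝ} (hq : ∑ k, q k = 1) :
    crossEntropy q (secondPhase P O H D 0).val.p = Real.log m := by
  simp only [crossEntropy, secondPhase_zero_p, ← Finset.sum_mul, hq, one_div, Real.log_inv,
    one_mul, neg_neg]

/-- The step size balances the growth `lam / 2 * ‖w - z‖ ^ 2` against the squared range of the
violations, which is at most `(Lg * ‖w - z‖) ^ 2` since they vanish at the feasible point `z`. -/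
theorem weightRegret_le (hP : P.Admissible lam Lf Lg rho) (hz : z ∈ P.feasible)
    (h0 : D.w₁ ∈ P.W) (hT : 0 < H.T₁) (hγ : 0 < H.γ) (hlam : 0 < H.lam) (hLg : 0 < Lg)
    (hη : H.η = H.lam / (2 * H.γ ^ 2 * Lg ^ 2)) {q : Fin m → ℝ} (hq : ∑ k, q k = 1) (n : ℕ) :
    weightRegret P O H D q n
      ≤ 2 * H.γ ^ 2 * Lg ^ 2 / H.lam * (crossEntropy q (secondPhase P O H D n).val.p
          - crossEntropy q (secondPhase P O H D (n + 1)).val.p)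
        + (H.lam / 8 * ‖(secondPhase P O H D n).val.w - z‖ ^ 2
          + H.lam / Lg ^ 2 * memCost P O H D n) := by
  have hregret := regret_pUpdate_le (H := H) (p := (secondPhase P O H D n).val.p)
    (mu := (secondPhase P O H D n).val.mu)
    (x := fun k => P.violation k (secondPhase P O H D n).val.w) hq (secondPhase_p_pos n)
    (secondPhase_p_mem_stdSimplex n).2 (by rw [hη]; positivity) hγ.le
    (fun k => ⟨violation_nonneg _ _, violation_le hP (secondPhase_w_mem hP h0 hT n) hz k⟩)
    (D.j (H.T₁ + n + 1))
  rw [secondPhase_succ_p]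
  refine hregret.trans_eq ?_
  simp only [memCost, memErr]
  rw [hη]
  field_simp
  ring

theorem sum_weightRegret_le (hP : P.Admissible lam Lf Lg rho) (hz : z ∈ P.feasible)
    (h0 : D.w₁ ∈ P.W) (hT : 0 < H.T₁) (hγ : 0 < H.γ) (hlam : 0 < H.lam) (hLg : 0 < Lg)
    (hη : H.η = H.lam / (2 * H.γ ^ 2 * Lg ^ 2)) {q : Fin m → ℝ}
    (hq : q ∈ stdSimplex ℝ (Fin m)) (N : ℕ) :
    ∑ n ∈ Finset.range N, weightRegret P O H D q n
      ≤ 2 * H.γ ^ 2 * Lg ^ 2 / H.lam * Real.log m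
        + ∑ n ∈ Finset.range N, (H.lam / 8 * ‖(secondPhase P O H D n).val.w - z‖ ^ 2
          + H.lam / Lg ^ 2 * memCost P O H D n) := by
  refine (Finset.sum_le_sum fun n _ =>
    weightRegret_le hP hz h0 hT hγ hlam hLg hη hq.2 n).trans ?_
  rw [Finset.sum_add_distrib, ← Finset.mul_sum, Finset.sum_range_sub',
    crossEntropy_secondPhase_zero hq.2]
  gcongr
  exact sub_le_self _ (crossEntropy_nonneg hq.1 (secondPhase_p_mem_stdSimplex N))

end Weights

section Directions

theorem add_sq_le_one_add_inv_mul_sq_add (a b : ℝ) {c : ℝ} (hc : 0 < c) :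
    (a + b) ^ 2 ≤ (1 + 1 / c) * a ^ 2 + (1 + c) * b ^ 2 := by
  have hgap : (1 + 1 / c) * a ^ 2 + (1 + c) * b ^ 2 - (a + b) ^ 2 = (a - c * b) ^ 2 / c := by
    field_simp
    ring
  have : 0 ≤ (a - c * b) ^ 2 / c := by positivity
  linarith

theorem memErr_zero (k : Fin m) : memErr P O H D 0 k = 0 := sub_self _

theorem memErr_succ (n : ℕ) (k : Fin m) :
    memErr P O H D (n + 1) k = (if D.j (H.T₁ + n + 1) = k then 0 else memErr P O H D n k)
      + (P.violation k (secondPhase P O H D (n + 1)).val.w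
        - P.violation k (secondPhase P O H D n).val.w) := by
  simp only [memErr, secondPhase_succ_mu]
  split_ifs <;> ring

theorem Oracle.Valid.norm_add_smul_grad_le (hO : O.Valid P Gg) (hγ : 0 ≤ H.γ) {v w : Vec d}
    (hv : ‖v‖ ≤ Gf) (hw : w ∈ P.W) (i : Fin m) : ‖v + H.γ • O.grad i w‖ ≤ Gf + H.γ * Gg := by
  refine (norm_add_le _ _).trans (add_le_add hv ?_)
  rw [norm_smul, Real.norm_eq_abs, abs_of_nonneg hγ]
  exact mul_le_mul_of_nonneg_left (hO.norm_le i w hw) hγ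

variable (hP : P.Admissible lam Lf Lg rho) (hO : O.Valid P Gg) (h0 : D.w₁ ∈ P.W)
  (hγ : 0 ≤ H.γ) (hsg : ∀ t, 1 ≤ t → t ≤ H.T₁ + H.T₂ → ‖D.sg t‖ ≤ Gf)

include hP hO h0 hγ hsg

theorem norm_firstDir_le {n : ℕ} (hn : n < H.T₁) : ‖firstDir P O H D n‖ ≤ Gf + H.γ * Gg :=
  hO.norm_add_smul_grad_le hγ (hsg _ (by omega) (by omega)) (firstPhase_mem hP h0 n) _

theorem norm_secondDir_le (hT : 0 < H.T₁) {n : ℕ} (hn : n < H.T₂) :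
    ‖secondDir P O H D n‖ ≤ Gf + H.γ * Gg :=
  hO.norm_add_smul_grad_le hγ (hsg _ (by omega) (by omega)) (secondPhase_w_mem hP h0 hT n) _

theorem sum_inner_firstDir_le (hlam : 0 < H.lam) (hz : z ∈ P.W) :
    ∑ n ∈ Finset.range H.T₁, (inner ℝ (firstDir P O H D n) ((firstPhase P O H D n).val - z)
        - H.lam / 2 * ‖(firstPhase P O H D n).val - z‖ ^ 2)
      ≤ (Gf + H.γ * Gg) ^ 2 / (2 * H.lam) * ∑ n ∈ Finset.range H.T₁, 1 / ((n + 1 : ℕ) : ℝ) := by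
  have hsum := sum_inner_sub_mul_sq_le (T := 0) (N := H.T₁)
    (x := fun n => (firstPhase P O H D n).val) hlam hP.closed hP.convex hz
    (fun n _ => by rw [zero_add]; exact firstPhase_succ n)
    (fun n hn => norm_firstDir_le hP hO h0 hγ hsg hn)
  simpa only [Nat.cast_zero, mul_zero, zero_mul, zero_add] using hsum

variable (hT : 0 < H.T₁) (hlam : 0 < H.lam)
include hT hlam

theorem sum_inner_secondDir_le (hz : z ∈ P.W) :
    ∑ n ∈ Finset.range H.T₂,
        (inner ℝ (secondDir P O H D n) ((secondPhase P O H D n).val.w - z)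
        - H.lam / 2 * ‖(secondPhase P O H D n).val.w - z‖ ^ 2)
      ≤ H.lam / 2 * H.T₁ * ‖firstAverage P O H D - z‖ ^ 2
        + (Gf + H.γ * Gg) ^ 2 / (2 * H.lam)
          * ∑ n ∈ Finset.range H.T₂, 1 / ((H.T₁ + n + 1 : ℕ) : ℝ) :=
  sum_inner_sub_mul_sq_le (x := fun n => (secondPhase P O H D n).val.w) hlam hP.closed
    hP.convex hz (fun n _ => secondPhase_succ_w n)
    (fun _ hn => norm_secondDir_le hP hO h0 hγ hsg hT hn)

theorem norm_secondPhase_succ_sub_le {n : ℕ} (hn : n < H.T₂) :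
    ‖(secondPhase P O H D (n + 1)).val.w - (secondPhase P O H D n).val.w‖
      ≤ (Gf + H.γ * Gg) / (H.lam * H.T₁) := by
  have hdir := norm_secondDir_le hP hO h0 hγ hsg hT hn
  have : (0 : ℝ) < H.T₁ := Nat.cast_pos.2 hT
  calc ‖(secondPhase P O H D (n + 1)).val.w - (secondPhase P O H D n).val.w‖
      ≤ |1 / (H.lam * ((H.T₁ + n + 1 : ℕ) : ℝ))| * ‖secondDir P O H D n‖ :=
        norm_proj_sub_smul_sub_le hP.closed hP.convex (secondPhase_w_mem hP h0 hT n) _ _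
    _ = 1 / (H.lam * ((H.T₁ + n + 1 : ℕ) : ℝ)) * ‖secondDir P O H D n‖ := by
        rw [abs_of_nonneg (by positivity)]
    _ ≤ 1 / (H.lam * H.T₁) * (Gf + H.γ * Gg) := by
        refine mul_le_mul (one_div_le_one_div_of_le (by positivity) ?_) hdir (norm_nonneg _)
          (by positivity)
        gcongr
        omega
    _ = (Gf + H.γ * Gg) / (H.lam * H.T₁) := one_div_mul_eq_div _ _

theorem abs_violation_secondPhase_succ_sub_le (hLg : 0 ≤ Lg) {n : ℕ} (hn : n < H.T₂)
    (k : Fin m) :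
    |P.violation k (secondPhase P O H D (n + 1)).val.w
        - P.violation k (secondPhase P O H D n).val.w|
      ≤ Lg * ((Gf + H.γ * Gg) / (H.lam * H.T₁)) :=
  (abs_violation_sub_le hP k (secondPhase_w_mem hP h0 hT _) (secondPhase_w_mem hP h0 hT _)).trans
    (mul_le_mul_of_nonneg_left (norm_secondPhase_succ_sub_le hP hO h0 hγ hsg hT hlam hn) hLg)

theorem memErr_succ_sq_le (hm : 0 < m) (hLg : 0 ≤ Lg) {n : ℕ} (hn : n < H.T₂) (k : Fin m) :
    memErr P O H D (n + 1) k ^ 2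
      ≤ (1 + 1 / (2 * m)) * (if D.j (H.T₁ + n + 1) = k then 0 else memErr P O H D n k ^ 2)
        + (1 + 2 * m) * (Lg * ((Gf + H.γ * Gg) / (H.lam * H.T₁))) ^ 2 := by
  have hdrift := sq_le_sq.2 ((abs_violation_secondPhase_succ_sub_le hP hO h0 hγ hsg hT hlam hLg
    hn k).trans (le_abs_self _))
  have hm' : (0 : ℝ) < 2 * m := by positivity
  rw [memErr_succ]
  refine (add_sq_le_one_add_inv_mul_sq_add _ _ hm').trans ?_
  rw [ite_pow, zero_pow two_ne_zero]
  gcongr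

end Directions

end Trajectory

section BoundedMeasurable

variable {Ω : Type*}

/-- Bounded real functions that are measurable with respect to the σ-algebra `m'`: they are
integrable, and those known at the time of a draw factor out of its conditional expectation. -/
structure BoundedMeasurable (m' : MeasurableSpace Ω) (φ : Ω → ℝ) : Prop where
  measurable : Measurable[m'] φ
  exists_bound : ∃ C, ∀ ω, |φ ω| ≤ C

namespace BoundedMeasurable

variable {m' m'' : MeasurableSpace Ω} {φ ψ : Ω → ℝ}

theorem const (c : ℝ) : BoundedMeasurable m' fun _ => c :=
  ⟨measurable_const, |c|, fun _ => le_rfl⟩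

theorem add (hφ : BoundedMeasurable m' φ) (hψ : BoundedMeasurable m' ψ) :
    BoundedMeasurable m' fun ω => φ ω + ψ ω := by
  obtain ⟨C, hC⟩ := hφ.exists_bound
  obtain ⟨C', hC'⟩ := hψ.exists_bound
  exact ⟨hφ.measurable.add hψ.measurable, C + C',
    fun ω => (abs_add_le _ _).trans (add_le_add (hC ω) (hC' ω))⟩

theorem mul (hφ : BoundedMeasurable m' φ) (hψ : BoundedMeasurable m' ψ) :
    BoundedMeasurable m' fun ω => φ ω * ψ ω := by
  obtain ⟨C, hC⟩ := hφ.exists_bound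
  obtain ⟨C', hC'⟩ := hψ.exists_bound
  refine ⟨hφ.measurable.mul hψ.measurable, C * C', fun ω => ?_⟩
  rw [abs_mul]
  exact mul_le_mul (hC ω) (hC' ω) (abs_nonneg _) ((abs_nonneg _).trans (hC ω))

theorem const_mul (c : ℝ) (hφ : BoundedMeasurable m' φ) :
    BoundedMeasurable m' fun ω => c * φ ω :=
  (const c).mul hφ

theorem sub (hφ : BoundedMeasurable m' φ) (hψ : BoundedMeasurable m' ψ) :
    BoundedMeasurable m' fun ω => φ ω - ψ ω := by
  simpa only [sub_eq_add_neg, neg_one_mul] using hφ.add (hψ.const_mul (-1))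

theorem sq (hφ : BoundedMeasurable m' φ) : BoundedMeasurable m' fun ω => φ ω ^ 2 := by
  simpa only [pow_two] using hφ.mul hφ

theorem sum {ι : Type*} (s : Finset ι) {φ : ι → Ω → ℝ}
    (hφ : ∀ i, BoundedMeasurable m' (φ i)) : BoundedMeasurable m' fun ω => ∑ i ∈ s, φ i ω := by
  choose C hC using fun i => (hφ i).exists_bound
  exact ⟨Finset.measurable_fun_sum s fun i _ => (hφ i).measurable, ∑ i ∈ s, C i,
    fun ω => (Finset.abs_sum_le_sum_abs _ _).trans (Finset.sum_le_sum fun i _ => hC i ω)⟩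

theorem mono (hφ : BoundedMeasurable m' φ) (hle : m' ≤ m'') : BoundedMeasurable m'' φ :=
  ⟨hφ.measurable.mono hle le_rfl, hφ.exists_bound⟩

theorem integrable {μ : Measure[m'] Ω} [IsFiniteMeasure μ] (hφ : BoundedMeasurable m' φ) :
    Integrable φ μ := by
  obtain ⟨C, hC⟩ := hφ.exists_bound
  exact Integrable.of_bound hφ.measurable.aestronglyMeasurable C (ae_of_all _ hC)

theorem comp_continuousOn {E : Type*} [TopologicalSpace E] [MeasurableSpace E]
    [OpensMeasurableSpace E] {S : Set E} (hS : IsCompact S) {f : E → ℝ} (hf : ContinuousOn f S)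
    {X : Ω → E} (hX : Measurable[m'] X) (hXS : ∀ ω, X ω ∈ S) :
    BoundedMeasurable m' fun ω => f (X ω) := by
  obtain ⟨C, hC⟩ := hS.exists_bound_of_continuousOn hf
  exact ⟨(continuousOn_iff_continuous_domRestrict.1 hf).measurable.comp
    (hX.subtype_mk (h := hXS)), C, fun ω => hC _ (hXS ω)⟩

theorem ite_eq {ι : Type*} [DecidableEq ι] [MeasurableSpace ι] [MeasurableSingletonClass ι]
    {j : Ω → ι} (hj : Measurable[m'] j) (k : ι) :
    BoundedMeasurable m' fun ω => if j ω = k then 1 else 0 := by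
  refine ⟨Measurable.ite (hj (measurableSet_singleton k)) measurable_const measurable_const, 1,
    fun ω => ?_⟩
  split_ifs <;> simp

end BoundedMeasurable

theorem measurable_apply_index {ι β : Type*} [Countable ι] [MeasurableSpace ι]
    [MeasurableSingletonClass ι] [MeasurableSpace β] {m' : MeasurableSpace Ω} {j : Ω → ι}
    {c : ι → Ω → β} (hj : Measurable[m'] j) (hc : ∀ k, Measurable[m'] (c k)) :
    Measurable[m'] fun ω => c (j ω) ω :=
  (measurable_from_prod_countable_right (f := fun x : ι × Ω => c x.1 x.2) hc).comp
    (hj.prodMk measurable_id)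

theorem BoundedMeasurable.apply_index {ι : Type*} [Finite ι] [MeasurableSpace ι]
    [MeasurableSingletonClass ι] {m' : MeasurableSpace Ω} {j : Ω → ι} {c : ι → Ω → ℝ}
    (hj : Measurable[m'] j) (hc : ∀ k, BoundedMeasurable m' (c k)) :
    BoundedMeasurable m' fun ω => c (j ω) ω := by
  choose C hC using fun k => (hc k).exists_bound
  obtain ⟨B, hB⟩ := (Set.finite_range C).bddAbove
  exact ⟨measurable_apply_index hj fun k => (hc k).measurable, B,
    fun ω => (hC _ ω).trans (hB ⟨_, rfl⟩)⟩

end BoundedMeasurable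

section ConditionalExpectation

variable {Ω : Type*} {m' mΩ : MeasurableSpace Ω} {μ : Measure Ω} [IsFiniteMeasure μ]

theorem integral_inner_condExp {E : Type*} [NormedAddCommGroup E] [InnerProductSpace ℝ E]
    [CompleteSpace E] (hm' : m' ≤ mΩ) {X Y : Ω → E} (hX : StronglyMeasurable[m'] X)
    (hYX : Integrable (fun ω => inner ℝ (Y ω) (X ω)) μ) (hY : Integrable Y μ) :
    ∫ ω, inner ℝ ((μ[Y | m']) ω) (X ω) ∂μ = ∫ ω, inner ℝ (Y ω) (X ω) ∂μ := by
  rw [← integral_condExp (f := fun ω => inner ℝ (Y ω) (X ω)) hm']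
  exact (integral_congr_ae
    (condExp_bilin_of_stronglyMeasurable_right (innerSL ℝ) hX hYX hY)).symm

theorem integral_apply_index {ι : Type*} [Fintype ι] [DecidableEq ι] [MeasurableSpace ι]
    [MeasurableSingletonClass ι] (hm' : m' ≤ mΩ) {j : Ω → ι} (hj : Measurable j)
    {c q : ι → Ω → ℝ} (hc : ∀ k, BoundedMeasurable m' (c k))
    (hq : ∀ k, ∀ᵐ ω ∂μ, (μ[fun ω' => if j ω' = k then (1 : ℝ) else 0 | m']) ω = q k ω) :
    ∫ ω, c (j ω) ω ∂μ = ∫ ω, ∑ k, q k ω * c k ω ∂μ := by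
  have hind (k : ι) : Integrable (fun ω => if j ω = k then (1 : ℝ) else 0) μ :=
    (BoundedMeasurable.ite_eq hj k).integrable
  have hprod (k : ι) : Integrable (fun ω => (if j ω = k then (1 : ℝ) else 0) * c k ω) μ :=
    ((BoundedMeasurable.ite_eq hj k).mul ((hc k).mono hm')).integrable
  have hpull (k : ι) : μ[fun ω => (if j ω = k then (1 : ℝ) else 0) * c k ω | m']
      =ᵐ[μ] fun ω => q k ω * c k ω := by
    filter_upwards [condExp_mul_of_stronglyMeasurable_right
      (hc k).measurable.stronglyMeasurable (hprod k) (hind k), hq k] with ω hω hqω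
    exact hω.trans (by rw [Pi.mul_apply, hqω])
  calc ∫ ω, c (j ω) ω ∂μ = ∫ ω, ∑ k, (if j ω = k then (1 : ℝ) else 0) * c k ω ∂μ := by
        simp only [ite_mul, one_mul, zero_mul, Finset.sum_ite_eq, Finset.mem_univ, if_true]
    _ = ∑ k, ∫ ω, q k ω * c k ω ∂μ := by
        rw [integral_finsetSum _ fun k _ => hprod k]
        exact Finset.sum_congr rfl fun k _ =>
          (integral_condExp hm').symm.trans (integral_congr_ae (hpull k))
    _ = ∫ ω, ∑ k, q k ω * c k ω ∂μ := (integral_finsetSum _ fun k _ =>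
        (integrable_congr (hpull k)).1 integrable_condExp).symm

omit [IsFiniteMeasure μ] in
theorem sum_integral_le_of_ae_sum_le {ι : Type*} {s : Finset ι} {φ : ι → Ω → ℝ} {ψ : Ω → ℝ}
    (hφ : ∀ n ∈ s, Integrable (φ n) μ) (hψ : Integrable ψ μ)
    (h : ∀ᵐ ω ∂μ, ∑ n ∈ s, φ n ω ≤ ψ ω) : ∑ n ∈ s, ∫ ω, φ n ω ∂μ ≤ ∫ ω, ψ ω ∂μ := by
  rw [← integral_finsetSum _ hφ]
  exact integral_mono_ae (integrable_finsetSum _ hφ) hψ h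

end ConditionalExpectation

section Adapted

variable {d m : ℕ} {Ω : Type*} {mΩ : MeasurableSpace Ω} {μ : Measure Ω} {F : Filtration ℕ mΩ}
  {P : Problem d m} {O : Oracle d m} {H : Hyper} {Gf Gg : ℝ} {D : Ω → Draws d m}
  {lam Lf Lg rho : ℝ} {m' : MeasurableSpace Ω}

theorem isCompact_W (hP : P.Admissible lam Lf Lg rho) : IsCompact P.W :=
  Metric.isCompact_of_isClosed_isBounded hP.closed hP.bounded

theorem boundedMeasurable_norm_sub_sq (hP : P.Admissible lam Lf Lg rho) (z : Vec d)
    {w : Ω → Vec d} (hw : Measurable[m'] w) (hwW : ∀ ω, w ω ∈ P.W) :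
    BoundedMeasurable m' fun ω => ‖w ω - z‖ ^ 2 :=
  .comp_continuousOn (isCompact_W hP) (f := fun w => ‖w - z‖ ^ 2) (by fun_prop) hw hwW

theorem boundedMeasurable_violation (hP : P.Admissible lam Lf Lg rho) (k : Fin m)
    {w : Ω → Vec d} (hw : Measurable[m'] w) (hwW : ∀ ω, w ω ∈ P.W) :
    BoundedMeasurable m' fun ω => P.violation k (w ω) :=
  .comp_continuousOn (isCompact_W hP) (continuousOn_violation hP k) hw hwW

theorem boundedMeasurable_penalized (hP : P.Admissible lam Lf Lg rho) (γ : ℝ)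
    {w : Ω → Vec d} (hw : Measurable[m'] w) (hwW : ∀ ω, w ω ∈ P.W) {q : Ω → Fin m → ℝ}
    (hq : ∀ k, BoundedMeasurable m' fun ω => q ω k) :
    BoundedMeasurable m' fun ω => P.penalized γ (q ω) (w ω) :=
  (BoundedMeasurable.comp_continuousOn (isCompact_W hP) (continuousOn_f hP) hw hwW).add
    ((BoundedMeasurable.sum _ fun k =>
      (hq k).mul (boundedMeasurable_violation hP k hw hwW)).const_mul γ)

theorem Oracle.Valid.measurable_grad_comp (hO : O.Valid P Gg) {i : Ω → Fin m} {w : Ω → Vec d}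
    (hi : Measurable[m'] i) (hw : Measurable[m'] w) :
    Measurable[m'] fun ω => O.grad (i ω) (w ω) :=
  measurable_apply_index (c := fun i ω => O.grad i (w ω)) hi
    fun i => (hO.measurable_grad i).comp hw

theorem Oracle.Valid.measurable_sel_comp (hP : P.Admissible lam Lf Lg rho) (hO : O.Valid P Gg)
    {w : Ω → Vec d} (hw : Measurable[m'] w) (hwW : ∀ ω, w ω ∈ P.W) :
    Measurable[m'] fun ω => O.sel fun i => P.g i (w ω) :=
  hO.measurable_sel.comp <| measurable_pi_lambda _ fun i =>
    (BoundedMeasurable.comp_continuousOn (isCompact_W hP)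
      (continuousOn_of_abs_sub_le_mul_norm (hP.lipschitz_g i)) hw hwW).measurable

theorem measurable_proj_sub_smul (hP : P.Admissible lam Lf Lg rho) (hne : P.W.Nonempty) (c : ℝ)
    {w v : Ω → Vec d} (hw : Measurable[m'] w) (hv : Measurable[m'] v) :
    Measurable[m'] fun ω => proj P.W (w ω - c • v ω) :=
  (continuous_proj hne hP.closed hP.convex).measurable.comp (hw.sub (hv.const_smul c))

theorem measurable_pGradient {mu : Ω → Fin m → ℝ} {j : Ω → Fin m} {y : Ω → ℝ}
    (hmu : ∀ k, Measurable[m'] fun ω => mu ω k) (hj : Measurable[m'] j) (hy : Measurable[m'] y)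
    (k : Fin m) : Measurable[m'] fun ω => pGradient H (mu ω) (j ω) (y ω) k :=
  ((hmu k).const_mul _).add <| Measurable.ite (measurableSet_eq_fun measurable_const hj)
    ((hy.sub (measurable_apply_index (c := fun k ω => mu ω k) hj hmu)).const_mul _)
    measurable_const

theorem measurable_pUpdate {p s : Ω → Fin m → ℝ} (hp : ∀ k, Measurable[m'] fun ω => p ω k)
    (hs : ∀ k, Measurable[m'] fun ω => s ω k) (k : Fin m) :
    Measurable[m'] fun ω => pUpdate H (p ω) (s ω) k := by
  have hexp (k : Fin m) :
      Measurable[m'] fun ω => Real.exp (Real.log (p ω k) + H.η * s ω k) :=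
    ((hp k).log.add ((hs k).const_mul _)).exp
  exact (hexp k).div (Finset.measurable_fun_sum _ fun l _ => (hexp l).abs)

section Run

variable (hrun : IsRun μ F P O H Gf D)
include hrun

theorem measurable_draw_i {n : ℕ} (hn : n < H.T₂) :
    Measurable[F (H.T₁ + n + 1)] fun ω => (D ω).i (H.T₁ + n + 1) :=
  hrun.i_meas _ (by omega) (by omega)

theorem measurable_draw_j {n : ℕ} (hn : n < H.T₂) :
    Measurable[F (H.T₁ + n + 1)] fun ω => (D ω).j (H.T₁ + n + 1) :=
  hrun.j_meas _ (by omega) (by omega)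

variable (hP : P.Admissible lam Lf Lg rho) (hne : P.W.Nonempty) (hO : O.Valid P Gg)
include hP hne hO

theorem measurable_firstPhase {n : ℕ} (hn : n ≤ H.T₁) :
    Measurable[F n] fun ω => (firstPhase P O H (D ω) n).val := by
  induction n with
  | zero => exact hrun.init_meas
  | succ n ih =>
    have hw : Measurable[F (n + 1)] fun ω => (firstPhase P O H (D ω) n).val :=
      (ih (by omega)).mono (F.mono n.le_succ) le_rfl
    have hi := hO.measurable_sel_comp hP hw fun ω => firstPhase_mem hP (hrun.init_mem ω) n
    exact measurable_proj_sub_smul hP hne _ hw ((hrun.sg_meas _ (by omega) (by omega)).add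
      ((hO.measurable_grad_comp hi hw).const_smul H.γ))

theorem measurable_firstAverage : Measurable[F H.T₁] fun ω => firstAverage P O H (D ω) := by
  refine (Finset.measurable_fun_sum _ fun n hn => ?_).const_smul (1 / (H.T₁ : ℝ))
  have hn := (Finset.mem_range.1 hn).le
  exact (measurable_firstPhase hrun hP hne hO hn).mono (F.mono hn) le_rfl

theorem measurable_secondPhase_w {n : ℕ} (hn : n ≤ H.T₂) :
    Measurable[F (H.T₁ + n)] fun ω => (secondPhase P O H (D ω) n).val.w := by
  induction n with
  | zero => exact measurable_firstAverage hrun hP hne hO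
  | succ n ih =>
    have hw : Measurable[F (H.T₁ + n + 1)] fun ω => (secondPhase P O H (D ω) n).val.w :=
      (ih (by omega)).mono (F.mono (Nat.le_succ _)) le_rfl
    exact measurable_proj_sub_smul hP hne _ hw ((hrun.sg_meas _ (by omega) (by omega)).add
      ((hO.measurable_grad_comp (measurable_draw_i hrun hn) hw).const_smul H.γ))

theorem measurable_average : Measurable[mΩ] fun ω => average P O H (D ω) := by
  refine (Finset.measurable_fun_sum _ fun n hn => ?_).const_smul (1 / (H.T₂ : ℝ))
  exact (measurable_secondPhase_w hrun hP hne hO (Finset.mem_range.1 hn).le).mono (F.le _) le_rfl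

variable (hT : 0 < H.T₁)
include hT

theorem boundedMeasurable_violation_secondPhase (k : Fin m) {n : ℕ} (hn : n ≤ H.T₂) :
    BoundedMeasurable (F (H.T₁ + n))
      fun ω => P.violation k (secondPhase P O H (D ω) n).val.w :=
  boundedMeasurable_violation hP k (measurable_secondPhase_w hrun hP hne hO hn)
    fun ω => secondPhase_w_mem hP (hrun.init_mem ω) hT n

theorem measurable_secondPhase_mu (k : Fin m) {n : ℕ} (hn : n ≤ H.T₂) :
    Measurable[F (H.T₁ + n)] fun ω => (secondPhase P O H (D ω) n).val.mu k := by
  induction n with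
  | zero => exact (boundedMeasurable_violation_secondPhase hrun hP hne hO hT k hn).measurable
  | succ n ih =>
    have hle : F (H.T₁ + n) ≤ F (H.T₁ + n + 1) := F.mono (Nat.le_succ _)
    simp only [secondPhase_succ_mu]
    exact Measurable.ite (measurable_draw_j hrun hn (measurableSet_singleton k))
      ((boundedMeasurable_violation_secondPhase hrun hP hne hO hT k
        (by omega)).measurable.mono hle le_rfl) ((ih (by omega)).mono hle le_rfl)

theorem measurable_secondPhase_p (k : Fin m) {n : ℕ} (hn : n ≤ H.T₂) :
    Measurable[F (H.T₁ + n)] fun ω => (secondPhase P O H (D ω) n).val.p k := by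
  induction n generalizing k with
  | zero => exact measurable_const
  | succ n ih =>
    have hle : F (H.T₁ + n) ≤ F (H.T₁ + n + 1) := F.mono (Nat.le_succ _)
    have hj := measurable_draw_j hrun hn
    exact measurable_pUpdate (fun k => (ih k (by omega)).mono hle le_rfl)
      (measurable_pGradient
        (fun k => (measurable_secondPhase_mu hrun hP hne hO hT k (by omega)).mono hle le_rfl) hj
        (measurable_apply_index (c := fun k ω => P.violation k (secondPhase P O H (D ω) n).val.w)
          hj fun k => (boundedMeasurable_violation_secondPhase hrun hP hne hO hT k
            (by omega)).measurable.mono hle le_rfl)) k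

theorem boundedMeasurable_secondPhase_mu (k : Fin m) {n : ℕ} (hn : n ≤ H.T₂) :
    BoundedMeasurable (F (H.T₁ + n)) fun ω => (secondPhase P O H (D ω) n).val.mu k := by
  choose C hC using fun l =>
    (isCompact_W hP).exists_bound_of_continuousOn (continuousOn_violation hP l)
  obtain ⟨B, hB⟩ := (Set.finite_range C).bddAbove
  refine ⟨measurable_secondPhase_mu hrun hP hne hO hT k hn, B, fun ω => ?_⟩
  have hmem := secondPhase_mu_mem (O := O) hP (hrun.init_mem ω) hT
    (fun l w hw => ((le_abs_self _).trans (hC l w hw)).trans (hB ⟨l, rfl⟩)) n k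
  rw [abs_of_nonneg hmem.1]
  exact hmem.2

theorem boundedMeasurable_secondPhase_p [Nonempty (Fin m)] (k : Fin m) {n : ℕ}
    (hn : n ≤ H.T₂) :
    BoundedMeasurable (F (H.T₁ + n)) fun ω => (secondPhase P O H (D ω) n).val.p k := by
  refine ⟨measurable_secondPhase_p hrun hP hne hO hT k hn, 1, fun ω => ?_⟩
  rw [abs_of_pos (secondPhase_p_pos n k)]
  exact (mem_Icc_of_mem_stdSimplex (secondPhase_p_mem_stdSimplex n) k).2

theorem boundedMeasurable_memErr (k : Fin m) {n : ℕ} (hn : n ≤ H.T₂) :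
    BoundedMeasurable (F (H.T₁ + n)) fun ω => memErr P O H (D ω) n k :=
  (boundedMeasurable_violation_secondPhase hrun hP hne hO hT k hn).sub
    (boundedMeasurable_secondPhase_mu hrun hP hne hO hT k hn)

end Run

section Integrable

variable [IsFiniteMeasure μ] (hrun : IsRun μ F P O H Gf D)
include hrun

omit [IsFiniteMeasure μ] in
theorem ae_norm_sg_le : ∀ᵐ ω ∂μ, ∀ t, 1 ≤ t → t ≤ H.T₁ + H.T₂ → ‖(D ω).sg t‖ ≤ Gf := by
  simp only [ae_all_iff]
  exact hrun.sg_bound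

theorem integrable_sg {t : ℕ} (h1 : 1 ≤ t) (h2 : t ≤ H.T₁ + H.T₂) :
    Integrable (fun ω => (D ω).sg t) μ :=
  Integrable.of_bound ((hrun.sg_meas t h1 h2).mono (F.le t) le_rfl).aestronglyMeasurable Gf
    (hrun.sg_bound t h1 h2)

variable (hP : P.Admissible lam Lf Lg rho) (hO : O.Valid P Gg) {z : Vec d}
include hP hO

theorem integrable_proj_average_norm_sub_sq [Nonempty (Fin m)] (hz : z ∈ P.feasible) :
    Integrable (fun ω => ‖proj P.feasible (average P O H (D ω)) - z‖ ^ 2) μ :=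
  (boundedMeasurable_norm_sub_sq hP z
    ((continuous_proj ⟨z, hz⟩ (isClosed_feasible hP) (convex_feasible hP)).measurable.comp
      (measurable_average hrun hP ⟨z, hz.1⟩ hO))
    fun _ => (proj_mem ⟨z, hz⟩ (isClosed_feasible hP) _).1).integrable

variable (hz : z ∈ P.W)
include hz

theorem integrable_firstPhase_norm_sub_sq {n : ℕ} (hn : n ≤ H.T₁) :
    Integrable (fun ω => ‖(firstPhase P O H (D ω) n).val - z‖ ^ 2) μ :=
  ((boundedMeasurable_norm_sub_sq hP z (measurable_firstPhase hrun hP ⟨z, hz⟩ hO hn)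
    fun ω => firstPhase_mem hP (hrun.init_mem ω) n).mono (F.le _)).integrable

variable (hT : 0 < H.T₁)
include hT

theorem integrable_firstAverage_norm_sub_sq :
    Integrable (fun ω => ‖firstAverage P O H (D ω) - z‖ ^ 2) μ :=
  ((boundedMeasurable_norm_sub_sq hP z (measurable_firstAverage hrun hP ⟨z, hz⟩ hO)
    fun ω => firstAverage_mem hP (hrun.init_mem ω) hT).mono (F.le _)).integrable

theorem integrable_secondPhase_norm_sub_sq {n : ℕ} (hn : n ≤ H.T₂) :
    Integrable (fun ω => ‖(secondPhase P O H (D ω) n).val.w - z‖ ^ 2) μ :=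
  ((boundedMeasurable_norm_sub_sq hP z (measurable_secondPhase_w hrun hP ⟨z, hz⟩ hO hn)
    fun ω => secondPhase_w_mem hP (hrun.init_mem ω) hT n).mono (F.le _)).integrable

theorem integrable_average_norm_sub_sq (hT₂ : 0 < H.T₂) :
    Integrable (fun ω => ‖average P O H (D ω) - z‖ ^ 2) μ :=
  (boundedMeasurable_norm_sub_sq hP z (measurable_average hrun hP ⟨z, hz⟩ hO)
    fun ω => average_secondPhase_mem hP (hrun.init_mem ω) hT hT₂).integrable

end Integrable

end Adapted

section Direction

variable {d m : ℕ} {Ω : Type*} {m' mΩ : MeasurableSpace Ω} {μ : Measure Ω} {P : Problem d m}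
  {O : Oracle d m} {Gg lam Lf Lg rho γ : ℝ} {z : Vec d}

theorem Oracle.Valid.violation_le_inner_grad (hO : O.Valid P Gg) (hz : z ∈ P.feasible)
    (k : Fin m) {w : Vec d} (hw : w ∈ P.W) :
    P.violation k w ≤ inner ℝ (O.grad k w) (w - z) := by
  have hsub : P.violation k w + inner ℝ (O.grad k w) (z - w) ≤ P.violation k z :=
    hO.subgradient k w hw z hz.1
  rw [violation_eq_zero hz k, ← neg_sub w z, inner_neg_right] at hsub
  linarith

theorem exists_norm_sub_le (hP : P.Admissible lam Lf Lg rho) (z : Vec d) :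
    ∃ C, ∀ w ∈ P.W, ‖w - z‖ ≤ C := by
  simpa only [norm_norm] using (isCompact_W hP).exists_bound_of_continuousOn
    (f := fun w => ‖w - z‖) (by fun_prop)

theorem boundedMeasurable_inner_grad (hP : P.Admissible lam Lf Lg rho) (hO : O.Valid P Gg)
    (z : Vec d) {i : Ω → Fin m} (hi : Measurable[m'] i) {w : Ω → Vec d} (hw : Measurable[m'] w)
    (hwW : ∀ ω, w ω ∈ P.W) :
    BoundedMeasurable m' fun ω => inner ℝ (O.grad (i ω) (w ω)) (w ω - z) := by
  obtain ⟨C, hC⟩ := exists_norm_sub_le hP z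
  refine ⟨(hO.measurable_grad_comp hi hw).inner (hw.sub_const _), Gg * C, fun ω => ?_⟩
  exact (abs_real_inner_le_norm _ _).trans (mul_le_mul (hO.norm_le _ _ (hwW ω)) (hC _ (hwW ω))
    (norm_nonneg _) ((norm_nonneg _).trans (hO.norm_le (i ω) _ (hwW ω))))

theorem integrable_inner_sub (hP : P.Admissible lam Lf Lg rho) (z : Vec d) {w Y : Ω → Vec d}
    (hw : Measurable[mΩ] w) (hwW : ∀ ω, w ω ∈ P.W) (hY : Integrable Y μ) :
    Integrable (fun ω => inner ℝ (Y ω) (w ω - z)) μ := by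
  obtain ⟨C, hC⟩ := exists_norm_sub_le hP z
  exact (innerSL ℝ).integrable_of_bilin_of_bdd_right C hY
    (hw.sub_const z).aestronglyMeasurable (ae_of_all _ fun ω => hC _ (hwW ω))

variable [IsFiniteMeasure μ]

theorem integrable_inner_add_smul_grad (hP : P.Admissible lam Lf Lg rho) (hO : O.Valid P Gg)
    (γ : ℝ) (z : Vec d) {w Y : Ω → Vec d} (hw : Measurable[mΩ] w) (hwW : ∀ ω, w ω ∈ P.W)
    (hY : Integrable Y μ) {i : Ω → Fin m} (hi : Measurable[mΩ] i) :
    Integrable (fun ω => inner ℝ (Y ω + γ • O.grad (i ω) (w ω)) (w ω - z)) μ := by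
  simp only [inner_add_left, real_inner_smul_left]
  exact (integrable_inner_sub hP z hw hwW hY).add
    ((boundedMeasurable_inner_grad hP hO z hi hw hwW).integrable.const_mul γ)

theorem penalized_sub_add_le_inner (hP : P.Admissible lam Lf Lg rho) (hO : O.Valid P Gg)
    (hz : z ∈ P.feasible) (hγ : 0 ≤ γ) {q : Fin m → ℝ} (hq : ∀ k, 0 ≤ q k) {w v : Vec d}
    (hw : w ∈ P.W) (hv : IsSubgradient P.W P.f w v) :
    P.penalized γ q w - P.f z + lam / 2 * ‖w - z‖ ^ 2
      ≤ inner ℝ v (w - z) + γ * ∑ k, q k * inner ℝ (O.grad k w) (w - z) := by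
  have hf := hv.add_sq_le hP.strongConvex hw hz.1
  rw [← neg_sub w z, inner_neg_right] at hf
  have hviolation : ∑ k, q k * P.violation k w ≤ ∑ k, q k * inner ℝ (O.grad k w) (w - z) :=
    Finset.sum_le_sum fun k _ =>
      mul_le_mul_of_nonneg_left (hO.violation_le_inner_grad hz k hw) (hq k)
  have hscaled := mul_le_mul_of_nonneg_left hviolation hγ
  rw [Problem.penalized]
  linarith

theorem integral_penalized_le_integral_inner (hP : P.Admissible lam Lf Lg rho)
    (hO : O.Valid P Gg) (hz : z ∈ P.feasible) (hγ : 0 ≤ γ) (hm' : m' ≤ mΩ) {w Y : Ω → Vec d}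
    (hw : Measurable[m'] w) (hwW : ∀ ω, w ω ∈ P.W) (hY : Integrable Y μ)
    (hsub : ∀ᵐ ω ∂μ, IsSubgradient P.W P.f (w ω) ((μ[Y | m']) ω)) {i : Ω → Fin m}
    (hi : Measurable[mΩ] i) {q : Ω → Fin m → ℝ}
    (hq : ∀ k, BoundedMeasurable m' fun ω => q ω k) (hq0 : ∀ ω k, 0 ≤ q ω k)
    (hlaw : ∀ k, ∀ᵐ ω ∂μ, (μ[fun ω' => if i ω' = k then (1 : ℝ) else 0 | m']) ω = q ω k) :
    ∫ ω, (P.penalized γ (q ω) (w ω) - P.f z + lam / 2 * ‖w ω - z‖ ^ 2) ∂μ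
      ≤ ∫ ω, inner ℝ (Y ω + γ • O.grad (i ω) (w ω)) (w ω - z) ∂μ := by
  have hwΩ : Measurable[mΩ] w := hw.mono hm' le_rfl
  have hgrad (k : Fin m) : BoundedMeasurable m' fun ω => inner ℝ (O.grad k (w ω)) (w ω - z) :=
    boundedMeasurable_inner_grad hP hO z measurable_const hw hwW
  have hmean : BoundedMeasurable m' fun ω =>
      γ * ∑ k, q ω k * inner ℝ (O.grad k (w ω)) (w ω - z) :=
    (BoundedMeasurable.sum _ fun k => (hq k).mul (hgrad k)).const_mul γ
  have hleft : BoundedMeasurable m' fun ω =>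
      P.penalized γ (q ω) (w ω) - P.f z + lam / 2 * ‖w ω - z‖ ^ 2 :=
    ((boundedMeasurable_penalized hP γ hw hwW hq).sub (.const _)).add
      ((boundedMeasurable_norm_sub_sq hP z hw hwW).const_mul _)
  have hYw := integrable_inner_sub hP z hwΩ hwW hY
  have hcond : Integrable (fun ω => inner ℝ ((μ[Y | m']) ω) (w ω - z)) μ :=
    integrable_inner_sub hP z hwΩ hwW integrable_condExp
  calc ∫ ω, (P.penalized γ (q ω) (w ω) - P.f z + lam / 2 * ‖w ω - z‖ ^ 2) ∂μ
      ≤ ∫ ω, (inner ℝ ((μ[Y | m']) ω) (w ω - z)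
          + γ * ∑ k, q ω k * inner ℝ (O.grad k (w ω)) (w ω - z)) ∂μ := by
        refine integral_mono_ae (hleft.mono hm').integrable
          (hcond.add (hmean.mono hm').integrable) ?_
        filter_upwards [hsub] with ω hω
        exact penalized_sub_add_le_inner hP hO hz hγ (hq0 ω) (hwW ω) hω
    _ = ∫ ω, inner ℝ (Y ω) (w ω - z) ∂μ
          + γ * ∫ ω, inner ℝ (O.grad (i ω) (w ω)) (w ω - z) ∂μ := by
        rw [integral_add hcond (hmean.mono hm').integrable, integral_const_mul,
          integral_inner_condExp hm' (hw.sub_const z).stronglyMeasurable hYw hY,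
          integral_apply_index (c := fun k ω => inner ℝ (O.grad k (w ω)) (w ω - z)) hm' hi hgrad
            hlaw]
    _ = ∫ ω, inner ℝ (Y ω + γ • O.grad (i ω) (w ω)) (w ω - z) ∂μ := by
        simp only [inner_add_left, real_inner_smul_left]
        rw [integral_add hYw
          ((boundedMeasurable_inner_grad hP hO z hi hwΩ hwW).integrable.const_mul γ),
          integral_const_mul]

theorem integral_violation_le_integral_inner (hP : P.Admissible lam Lf Lg rho)
    (hO : O.Valid P Gg) (hz : z ∈ P.feasible) (hγ : 0 ≤ γ) (hm' : m' ≤ mΩ) {w Y : Ω → Vec d}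
    (hw : Measurable[m'] w) (hwW : ∀ ω, w ω ∈ P.W) (hY : Integrable Y μ)
    (hsub : ∀ᵐ ω ∂μ, IsSubgradient P.W P.f (w ω) ((μ[Y | m']) ω)) {i : Ω → Fin m}
    (hi : Measurable[m'] i) :
    ∫ ω, (P.f (w ω) + γ * P.violation (i ω) (w ω) - P.f z + lam / 2 * ‖w ω - z‖ ^ 2) ∂μ
      ≤ ∫ ω, inner ℝ (Y ω + γ • O.grad (i ω) (w ω)) (w ω - z) ∂μ := by
  have hind (k : Fin m) : BoundedMeasurable m' fun ω => if i ω = k then (1 : ℝ) else 0 :=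
    .ite_eq hi k
  have hsingle (k : Fin m) : (fun ω => (Pi.single (i ω) 1 : Fin m → ℝ) k)
      = fun ω => if i ω = k then (1 : ℝ) else 0 := by
    ext ω
    simp only [Pi.single_apply, eq_comm]
  have hdir := integral_penalized_le_integral_inner hP hO hz hγ hm' hw hwW hY hsub
    (hi.mono hm' le_rfl) (q := fun ω => Pi.single (i ω) 1)
    (fun k => (hsingle k).symm ▸ hind k)
    (fun ω k => by rw [Pi.single_apply]; split_ifs <;> norm_num)
    (fun k => by
      rw [condExp_of_stronglyMeasurable hm' (hind k).measurable.stronglyMeasurable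
        ((hind k).mono hm').integrable]
      exact ae_of_all _ (congrFun (hsingle k).symm))
  simpa only [penalized_single] using hdir

end Direction

section Expectation

variable {d m : ℕ} {Ω : Type*} {mΩ : MeasurableSpace Ω} {μ : Measure Ω} [IsFiniteMeasure μ]
  {F : Filtration ℕ mΩ} {P : Problem d m} {O : Oracle d m} {H : Hyper} {Gf Gg : ℝ}
  {D : Ω → Draws d m} {lam Lf Lg rho : ℝ} {z : Vec d}

section FirstPhase

variable (hrun : IsRun μ F P O H Gf D) (hP : P.Admissible H.lam Lf Lg rho) (hO : O.Valid P Gg)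
include hrun hP hO

theorem integrable_inner_firstDir (hne : P.W.Nonempty) {n : ℕ} (hn : n < H.T₁) :
    Integrable (fun ω => inner ℝ (firstDir P O H (D ω) n)
      ((firstPhase P O H (D ω) n).val - z)) μ := by
  have hw := (measurable_firstPhase hrun hP hne hO hn.le).mono (F.le n) le_rfl
  have hwW (ω : Ω) := firstPhase_mem (O := O) (H := H) hP (hrun.init_mem ω) n
  exact integrable_inner_add_smul_grad hP hO H.γ z hw hwW
    (integrable_sg hrun (by omega) (by omega)) (hO.measurable_sel_comp hP hw hwW)

variable (hz : z ∈ P.feasible) (hγ : 0 ≤ H.γ) {q : Fin m → ℝ} (hq : q ∈ stdSimplex ℝ (Fin m))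
  (hgrowth : ∀ w ∈ P.W, P.f z + H.lam / 2 * ‖w - z‖ ^ 2 ≤ P.penalized H.γ q w)
include hz hγ hq hgrowth

/-- The selected constraint is a most violated one, so that penalizing it alone penalizes at least
as much as the weights `q`. -/
theorem mul_integral_firstPhase_le {n : ℕ} (hn : n < H.T₁) :
    H.lam * ∫ ω, ‖(firstPhase P O H (D ω) n).val - z‖ ^ 2 ∂μ
      ≤ ∫ ω, inner ℝ (firstDir P O H (D ω) n) ((firstPhase P O H (D ω) n).val - z) ∂μ := by
  set w : Ω → Vec d := fun ω => (firstPhase P O H (D ω) n).val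
  have hw : Measurable[F n] w := measurable_firstPhase hrun hP ⟨z, hz.1⟩ hO hn.le
  have hwW (ω : Ω) : w ω ∈ P.W := firstPhase_mem hP (hrun.init_mem ω) n
  have hi := hO.measurable_sel_comp hP hw hwW
  have hX := boundedMeasurable_norm_sub_sq hP z hw hwW
  have hf := BoundedMeasurable.comp_continuousOn (isCompact_W hP) (continuousOn_f hP) hw hwW
  have hviolation := BoundedMeasurable.apply_index hi
    fun k => boundedMeasurable_violation hP k hw hwW
  refine le_trans ?_ (integral_violation_le_integral_inner hP hO hz hγ (F.le n) hw hwW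
    (integrable_sg hrun (by omega) (by omega)) (hrun.sg_first n hn) hi)
  rw [← integral_const_mul]
  refine integral_mono ((hX.const_mul _).mono (F.le n)).integrable
    ((((hf.add (hviolation.const_mul _)).sub (.const _)).add
      (hX.const_mul _)).mono (F.le n)).integrable fun ω => ?_
  have hmax := penalized_le_of_isMax hγ hq (hO.sel_max fun k => P.g k (w ω))
  have hlow := hgrowth (w ω) (hwW ω)
  simp only
  linarith

omit [IsFiniteMeasure μ] in
theorem mul_sum_integral_firstPhase_le [IsProbabilityMeasure μ] (hlam : 0 < H.lam) :
    H.lam / 2 * ∑ n ∈ Finset.range H.T₁, ∫ ω, ‖(firstPhase P O H (D ω) n).val - z‖ ^ 2 ∂μ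
      ≤ (Gf + H.γ * Gg) ^ 2 / (2 * H.lam)
        * ∑ n ∈ Finset.range H.T₁, 1 / ((n + 1 : ℕ) : ℝ) := by
  have hX {n : ℕ} (hn : n < H.T₁) : Integrable
      (fun ω => H.lam / 2 * ‖(firstPhase P O H (D ω) n).val - z‖ ^ 2) μ :=
    (integrable_firstPhase_norm_sub_sq hrun hP hO hz.1 hn.le).const_mul _
  have hA {n : ℕ} (hn : n < H.T₁) :=
    integrable_inner_firstDir (z := z) hrun hP hO ⟨z, hz.1⟩ hn
  rw [Finset.mul_sum]
  refine (Finset.sum_le_sum fun n hn => ?_).trans ((sum_integral_le_of_ae_sum_le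
    (fun n hn => (hA (Finset.mem_range.1 hn)).sub (hX (Finset.mem_range.1 hn)))
    (integrable_const _) ((ae_norm_sg_le hrun).mono fun ω hω =>
      sum_inner_firstDir_le hP hO (hrun.init_mem ω) hγ hω hlam hz.1)).trans_eq ?_)
  · have hn := Finset.mem_range.1 hn
    simp only [Pi.sub_apply]
    rw [integral_sub (hA hn) (hX hn), integral_const_mul]
    linarith [mul_integral_firstPhase_le hrun hP hO hz hγ hq hgrowth hn]
  · rw [integral_const, probReal_univ, one_smul]

omit [IsFiniteMeasure μ] in
theorem integral_firstAverage_le [IsProbabilityMeasure μ] (hlam : 0 < H.lam) (hT : 0 < H.T₁) :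
    H.lam / 2 * H.T₁ * ∫ ω, ‖firstAverage P O H (D ω) - z‖ ^ 2 ∂μ
      ≤ (Gf + H.γ * Gg) ^ 2 / (2 * H.lam)
        * ∑ n ∈ Finset.range H.T₁, 1 / ((n + 1 : ℕ) : ℝ) := by
  have hX (n : ℕ) (hn : n ∈ Finset.range H.T₁) :=
    integrable_firstPhase_norm_sub_sq (μ := μ) hrun hP hO hz.1 (Finset.mem_range.1 hn).le
  have hjensen : ∫ ω, ‖firstAverage P O H (D ω) - z‖ ^ 2 ∂μ
      ≤ 1 / (H.T₁ : ℝ)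
        * ∑ n ∈ Finset.range H.T₁, ∫ ω, ‖(firstPhase P O H (D ω) n).val - z‖ ^ 2 ∂μ := by
    rw [← integral_finsetSum _ hX, ← integral_const_mul]
    exact integral_mono (integrable_firstAverage_norm_sub_sq hrun hP hO hz.1 hT)
      ((integrable_finsetSum _ hX).const_mul _) fun ω => norm_average_sub_sq_le _ _ hT
  refine le_trans ?_ (mul_sum_integral_firstPhase_le hrun hP hO hz hγ hq hgrowth hlam)
  refine (mul_le_mul_of_nonneg_left hjensen (by positivity)).trans_eq ?_
  field_simp

end FirstPhase

end Expectation

section Unbiased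

variable {d m : ℕ} {P : Problem d m} {H : Hyper}

theorem sum_pGradient (mu x : Fin m → ℝ) (k : Fin m) :
    ∑ l, pGradient H mu l (x l) k = m * (H.γ * x k) := by
  simp only [pGradient, Finset.sum_add_distrib, Finset.sum_ite_eq, Finset.mem_univ, if_true,
    Finset.sum_const, Finset.card_univ, Fintype.card_fin, nsmul_eq_mul]
  ring

theorem penalized_sub_penalized (γ : ℝ) (q p : Fin m → ℝ) (w : Vec d) :
    P.penalized γ q w - P.penalized γ p w = γ * ∑ k, (q k - p k) * P.violation k w := by
  simp only [Problem.penalized, sub_mul, Finset.sum_sub_distrib]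
  ring

theorem average_regret_eq_penalized_sub [Nonempty (Fin m)] (mu q p : Fin m → ℝ) (w : Vec d) :
    ∑ l, 1 / (m : ℝ) * ∑ k, (q k - p k) * pGradient H mu l (P.violation l w) k
      = P.penalized H.γ q w - P.penalized H.γ p w := by
  have : (m : ℝ) ≠ 0 := Nat.cast_ne_zero.2 (Fin.pos_iff_nonempty.2 ‹_›).ne'
  rw [← Finset.mul_sum, Finset.sum_comm, penalized_sub_penalized, Finset.mul_sum, Finset.mul_sum]
  refine Finset.sum_congr rfl fun k _ => ?_
  rw [← Finset.mul_sum, sum_pGradient (x := fun l => P.violation l w)]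
  field_simp

end Unbiased

theorem sum_one_div_add_sum_one_div_le (T N : ℕ) :
    ∑ n ∈ Finset.range T, 1 / ((n + 1 : ℕ) : ℝ)
      + ∑ n ∈ Finset.range N, 1 / ((T + n + 1 : ℕ) : ℝ) ≤ 1 + Real.log (T + N) := by
  rw [← Finset.sum_range_add (fun n => 1 / ((n + 1 : ℕ) : ℝ))]
  have hharmonic := harmonic_le_one_add_log (T + N)
  rw [harmonic] at hharmonic
  push_cast at hharmonic ⊢
  simpa only [one_div] using hharmonic

section SecondPhase

variable {d m : ℕ} {Ω : Type*} {mΩ : MeasurableSpace Ω} {μ : Measure Ω}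
  {F : Filtration ℕ mΩ} {P : Problem d m} {O : Oracle d m} {H : Hyper} {Gf Gg : ℝ}
  {D : Ω → Draws d m} {lam Lf Lg rho : ℝ} {z : Vec d} {q : Fin m → ℝ} {n : ℕ}

section OneStep

variable [IsFiniteMeasure μ] (hrun : IsRun μ F P O H Gf D)
  (hP : P.Admissible lam Lf Lg rho) (hO : O.Valid P Gg) (hT : 0 < H.T₁) (hn : n < H.T₂)
include hrun hP hO hT hn

theorem integrable_inner_secondDir (hne : P.W.Nonempty) :
    Integrable (fun ω => inner ℝ (secondDir P O H (D ω) n)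
      ((secondPhase P O H (D ω) n).val.w - z)) μ :=
  integrable_inner_add_smul_grad hP hO H.γ z
    ((measurable_secondPhase_w hrun hP hne hO hn.le).mono (F.le _) le_rfl)
    (fun ω => secondPhase_w_mem hP (hrun.init_mem ω) hT n)
    (integrable_sg hrun (by omega) (by omega))
    ((measurable_draw_i hrun hn).mono (F.le _) le_rfl)

theorem integral_memErr_j_sq (hne : P.W.Nonempty) :
    ∫ ω, memErr P O H (D ω) n ((D ω).j (H.T₁ + n + 1)) ^ 2 ∂μ
      = 1 / (m : ℝ) * ∑ k, ∫ ω, memErr P O H (D ω) n k ^ 2 ∂μ := by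
  have herr (k : Fin m) := (boundedMeasurable_memErr hrun hP hne hO hT k hn.le).sq
  rw [integral_apply_index (c := fun k ω => memErr P O H (D ω) n k ^ 2) (F.le (H.T₁ + n))
    ((measurable_draw_j hrun hn).mono (F.le _) le_rfl) herr (hrun.j_law n hn)]
  simp only [← Finset.mul_sum]
  rw [integral_const_mul, integral_finsetSum _ fun k _ => ((herr k).mono (F.le _)).integrable]

omit [IsFiniteMeasure μ] in
theorem boundedMeasurable_memErr_j_sq (hne : P.W.Nonempty) :
    BoundedMeasurable mΩ fun ω => memErr P O H (D ω) n ((D ω).j (H.T₁ + n + 1)) ^ 2 :=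
  .apply_index (c := fun k ω => memErr P O H (D ω) n k ^ 2)
    ((measurable_draw_j hrun hn).mono (F.le _) le_rfl)
    fun k => ((boundedMeasurable_memErr hrun hP hne hO hT k hn.le).mono (F.le _)).sq

omit [IsFiniteMeasure μ] in
theorem boundedMeasurable_memCost (hne : P.W.Nonempty) :
    BoundedMeasurable mΩ fun ω => memCost P O H (D ω) n :=
  (BoundedMeasurable.sum _ fun k =>
      ((boundedMeasurable_memErr hrun hP hne hO hT k hn.le).mono (F.le _)).sq).add
    ((boundedMeasurable_memErr_j_sq hrun hP hO hT hn hne).const_mul _)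

theorem integral_memErr_sq_of_not_drawn (hne : P.W.Nonempty) (k : Fin m) :
    ∫ ω, (if (D ω).j (H.T₁ + n + 1) = k then 0 else memErr P O H (D ω) n k ^ 2) ∂μ
      = (1 - 1 / m) * ∫ ω, memErr P O H (D ω) n k ^ 2 ∂μ := by
  have herr := (boundedMeasurable_memErr hrun hP hne hO hT k hn.le).sq
  have hm : (m : ℝ) ≠ 0 := Nat.cast_ne_zero.2 (Fin.pos k).ne'
  have hcases (l : Fin m) : BoundedMeasurable (F (H.T₁ + n))
      fun ω => if l = k then 0 else memErr P O H (D ω) n k ^ 2 := by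
    split_ifs
    exacts [.const 0, herr]
  rw [integral_apply_index (c := fun l ω => if l = k then 0 else memErr P O H (D ω) n k ^ 2)
    (F.le (H.T₁ + n)) ((measurable_draw_j hrun hn).mono (F.le _) le_rfl) hcases
    (hrun.j_law n hn), ← integral_const_mul]
  congr 1 with ω
  have hcount : ∑ l, (if l = k then 0 else memErr P O H (D ω) n k ^ 2)
      = (m - 1) * memErr P O H (D ω) n k ^ 2 := by
    rw [Finset.sum_ite, Finset.sum_const_zero, zero_add, Finset.sum_const, Finset.filter_ne',
      Finset.card_erase_of_mem (Finset.mem_univ k), Finset.card_univ, Fintype.card_fin,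
      nsmul_eq_mul, Nat.cast_pred (Fin.pos k)]
  rw [← Finset.mul_sum, hcount]
  field_simp

variable [Nonempty (Fin m)]

omit [IsFiniteMeasure μ] in
theorem boundedMeasurable_regret_index (hne : P.W.Nonempty) (l : Fin m) :
    BoundedMeasurable (F (H.T₁ + n)) fun ω => ∑ k, (q k - (secondPhase P O H (D ω) n).val.p k)
      * pGradient H (secondPhase P O H (D ω) n).val.mu l
        (P.violation l (secondPhase P O H (D ω) n).val.w) k := by
  have hmu (k : Fin m) := boundedMeasurable_secondPhase_mu hrun hP hne hO hT k hn.le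
  refine .sum _ fun k =>
    ((BoundedMeasurable.const _).sub (boundedMeasurable_secondPhase_p hrun hP hne hO hT k
      hn.le)).mul (((hmu k).const_mul _).add ?_)
  split_ifs
  exacts [((boundedMeasurable_violation_secondPhase hrun hP hne hO hT l hn.le).sub
    (hmu l)).const_mul _, .const 0]

theorem integrable_weightRegret (hne : P.W.Nonempty) (q : Fin m → ℝ) :
    Integrable (fun ω => weightRegret P O H (D ω) q n) μ :=
  (BoundedMeasurable.apply_index ((measurable_draw_j hrun hn).mono (F.le _) le_rfl) fun l =>
    (boundedMeasurable_regret_index hrun hP hO hT hn hne l).mono (F.le _)).integrable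

theorem integral_weightRegret (hne : P.W.Nonempty) (q : Fin m → ℝ) :
    ∫ ω, weightRegret P O H (D ω) q n ∂μ
      = ∫ ω, (P.penalized H.γ q (secondPhase P O H (D ω) n).val.w
        - P.penalized H.γ (secondPhase P O H (D ω) n).val.p
          (secondPhase P O H (D ω) n).val.w) ∂μ := by
  refine (integral_apply_index (F.le (H.T₁ + n))
    ((measurable_draw_j hrun hn).mono (F.le _) le_rfl)
    (boundedMeasurable_regret_index hrun hP hO hT hn hne) (hrun.j_law n hn)).trans ?_
  simp only [average_regret_eq_penalized_sub]


end OneStep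

section Growth

variable [IsFiniteMeasure μ] [Nonempty (Fin m)] (hrun : IsRun μ F P O H Gf D)
  (hP : P.Admissible H.lam Lf Lg rho) (hO : O.Valid P Gg) (hT : 0 < H.T₁) (hn : n < H.T₂)
include hrun hP hO hT hn

theorem integral_penalized_secondPhase_le (hz : z ∈ P.feasible) (hγ : 0 ≤ H.γ) :
    ∫ ω, (P.penalized H.γ (secondPhase P O H (D ω) n).val.p (secondPhase P O H (D ω) n).val.w
        - P.f z + H.lam / 2 * ‖(secondPhase P O H (D ω) n).val.w - z‖ ^ 2) ∂μ
      ≤ ∫ ω, inner ℝ (secondDir P O H (D ω) n) ((secondPhase P O H (D ω) n).val.w - z) ∂μ :=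
  integral_penalized_le_integral_inner hP hO hz hγ (F.le (H.T₁ + n))
    (measurable_secondPhase_w hrun hP ⟨z, hz.1⟩ hO hn.le)
    (fun ω => secondPhase_w_mem hP (hrun.init_mem ω) hT n)
    (integrable_sg hrun (by omega) (by omega)) (hrun.sg_second n hn)
    ((measurable_draw_i hrun hn).mono (F.le _) le_rfl)
    (fun k => boundedMeasurable_secondPhase_p hrun hP ⟨z, hz.1⟩ hO hT k hn.le)
    (fun _ k => (secondPhase_p_pos n k).le) (hrun.i_law n hn)

/-- The two regrets, of the iterate and of the weights, add up to a duality gap: the penalized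
values at `p` cancel. -/
theorem mul_integral_secondPhase_le (hz : z ∈ P.feasible) (hγ : 0 ≤ H.γ)
    (hgrowth : ∀ w ∈ P.W, P.f z + H.lam / 2 * ‖w - z‖ ^ 2 ≤ P.penalized H.γ q w) :
    H.lam * ∫ ω, ‖(secondPhase P O H (D ω) n).val.w - z‖ ^ 2 ∂μ
      ≤ ∫ ω, inner ℝ (secondDir P O H (D ω) n) ((secondPhase P O H (D ω) n).val.w - z) ∂μ
        + ∫ ω, weightRegret P O H (D ω) q n ∂μ := by
  set w : Ω → Vec d := fun ω => (secondPhase P O H (D ω) n).val.w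
  set p : Ω → Fin m → ℝ := fun ω => (secondPhase P O H (D ω) n).val.p
  have hw : Measurable[F (H.T₁ + n)] w := measurable_secondPhase_w hrun hP ⟨z, hz.1⟩ hO hn.le
  have hwW (ω : Ω) : w ω ∈ P.W := secondPhase_w_mem hP (hrun.init_mem ω) hT n
  have hX := boundedMeasurable_norm_sub_sq hP z hw hwW
  have hp := boundedMeasurable_penalized hP H.γ hw hwW
    fun k => boundedMeasurable_secondPhase_p hrun hP ⟨z, hz.1⟩ hO hT k hn.le
  have hq := boundedMeasurable_penalized hP H.γ hw hwW fun k => .const (q k)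
  have hgap := (((hp.sub (.const (P.f z))).add (hX.const_mul (H.lam / 2))).mono
    (F.le _)).integrable (μ := μ)
  refine le_trans ?_ (add_le_add_left
    (integral_penalized_secondPhase_le hrun hP hO hT hn hz hγ) _)
  rw [integral_weightRegret hrun hP hO hT hn ⟨z, hz.1⟩, ← integral_add hgap
    ((hq.sub hp).mono (F.le _)).integrable, ← integral_const_mul]
  refine integral_mono ((hX.const_mul _).mono (F.le _)).integrable
    (hgap.add ((hq.sub hp).mono (F.le _)).integrable) fun ω => ?_
  have hlow := hgrowth (w ω) (hwW ω)
  simp only [w] at hlow ⊢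
  linarith

end Growth

section Memory

variable [IsProbabilityMeasure μ] (hrun : IsRun μ F P O H Gf D)
  (hP : P.Admissible lam Lf Lg rho) (hO : O.Valid P Gg) (hT : 0 < H.T₁) (hγ : 0 ≤ H.γ)
  (hlam : 0 < H.lam) (hLg : 0 ≤ Lg) (hne : P.W.Nonempty)
include hrun hP hO hT hγ hlam hLg hne

theorem integral_memErr_succ_sq_le (hn : n < H.T₂) (k : Fin m) :
    ∫ ω, memErr P O H (D ω) (n + 1) k ^ 2 ∂μ
      ≤ (1 - 1 / (2 * m)) * ∫ ω, memErr P O H (D ω) n k ^ 2 ∂μ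
        + (1 + 2 * m) * (Lg * ((Gf + H.γ * Gg) / (H.lam * H.T₁))) ^ 2 := by
  have hm : 0 < (m : ℝ) := Nat.cast_pos.2 (Fin.pos k)
  set drift := (1 + 2 * (m : ℝ)) * (Lg * ((Gf + H.γ * Gg) / (H.lam * H.T₁))) ^ 2
  have hkept := ((BoundedMeasurable.apply_index
    (c := fun l ω => if l = k then 0 else memErr P O H (D ω) n k ^ 2)
    ((measurable_draw_j hrun hn).mono (F.le _) le_rfl) fun l => by
      split_ifs
      exacts [.const 0, ((boundedMeasurable_memErr hrun hP hne hO hT k hn.le).mono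
        (F.le _)).sq]).const_mul (1 + 1 / (2 * (m : ℝ)))).integrable (μ := μ)
  have hcontract : (1 + 1 / (2 * (m : ℝ))) * (1 - 1 / m) ≤ 1 - 1 / (2 * m) := by
    have : (1 + 1 / (2 * (m : ℝ))) * (1 - 1 / m) = 1 - 1 / (2 * m) - 1 / (2 * m ^ 2) := by
      field_simp
      ring
    rw [this]
    exact sub_le_self _ (by positivity)
  calc ∫ ω, memErr P O H (D ω) (n + 1) k ^ 2 ∂μ
      ≤ ∫ ω, ((1 + 1 / (2 * m)) * (if (D ω).j (H.T₁ + n + 1) = k then 0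
          else memErr P O H (D ω) n k ^ 2) + drift) ∂μ := by
        refine integral_mono_ae ((boundedMeasurable_memErr hrun hP hne hO hT k hn).mono
          (F.le _)).sq.integrable (hkept.add (integrable_const _)) ?_
        filter_upwards [ae_norm_sg_le hrun] with ω hω
        exact memErr_succ_sq_le hP hO (hrun.init_mem ω) hγ hω hT hlam (Fin.pos k) hLg hn k
    _ = (1 + 1 / (2 * m)) * (1 - 1 / m) * ∫ ω, memErr P O H (D ω) n k ^ 2 ∂μ + drift := by
        rw [integral_add hkept (integrable_const _), integral_const_mul,
          integral_memErr_sq_of_not_drawn hrun hP hO hT hn hne, integral_const, probReal_univ,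
          one_smul, mul_assoc]
    _ ≤ (1 - 1 / (2 * m)) * ∫ ω, memErr P O H (D ω) n k ^ 2 ∂μ + drift := by
        gcongr

theorem integral_memErr_sq_le (hn : n ≤ H.T₂) (k : Fin m) :
    ∫ ω, memErr P O H (D ω) n k ^ 2 ∂μ
      ≤ 6 * m ^ 2 * (Lg * ((Gf + H.γ * Gg) / (H.lam * H.T₁))) ^ 2 := by
  induction n with
  | zero =>
    simp only [memErr_zero, zero_pow two_ne_zero, integral_zero]
    positivity
  | succ n ih =>
    refine (integral_memErr_succ_sq_le hrun hP hO hT hγ hlam hLg hne hn k).trans ?_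
    have hm : (1 : ℝ) ≤ m := Nat.one_le_cast.2 (Fin.pos k)
    set r := (Lg * ((Gf + H.γ * Gg) / (H.lam * H.T₁))) ^ 2
    calc (1 - 1 / (2 * (m : ℝ))) * ∫ ω, memErr P O H (D ω) n k ^ 2 ∂μ + (1 + 2 * m) * r
        ≤ (1 - 1 / (2 * (m : ℝ))) * (6 * m ^ 2 * r) + (1 + 2 * m) * r := by
          have : 0 ≤ 1 - 1 / (2 * (m : ℝ)) := by
            rw [sub_nonneg, div_le_one (by positivity)]
            linarith
          gcongr
          exact ih (by omega)
      _ = 6 * m ^ 2 * r - (m - 1) * r := by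
          field_simp
          ring
      _ ≤ 6 * m ^ 2 * r := sub_le_self _ (mul_nonneg (sub_nonneg.2 hm) (sq_nonneg _))

theorem integral_memCost_le [Nonempty (Fin m)] (hn : n < H.T₂) :
    ∫ ω, memCost P O H (D ω) n ∂μ
      ≤ 12 * m ^ 4 * (Lg * ((Gf + H.γ * Gg) / (H.lam * H.T₁))) ^ 2 := by
  have hm : (1 : ℝ) ≤ m := Nat.one_le_cast.2 (Fin.pos_iff_nonempty.2 ‹_›)
  set r := (Lg * ((Gf + H.γ * Gg) / (H.lam * H.T₁))) ^ 2
  have herr (k : Fin m) := ((boundedMeasurable_memErr hrun hP hne hO hT k hn.le).mono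
    (F.le _)).sq.integrable (μ := μ)
  have hj := (boundedMeasurable_memErr_j_sq hrun hP hO hT hn hne).integrable (μ := μ)
  calc ∫ ω, memCost P O H (D ω) n ∂μ
      = (1 + m) * ∑ k, ∫ ω, memErr P O H (D ω) n k ^ 2 ∂μ := by
        simp only [memCost]
        rw [integral_add (integrable_finsetSum _ fun k _ => herr k) (hj.const_mul _),
          integral_finsetSum _ fun k _ => herr k, integral_const_mul,
          integral_memErr_j_sq hrun hP hO hT hn hne]
        field_simp
    _ ≤ (1 + m) * ∑ _k : Fin m, 6 * m ^ 2 * r := by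
        gcongr with k
        exact integral_memErr_sq_le hrun hP hO hT hγ hlam hLg hne hn.le k
    _ = (m + 1) * (6 * m ^ 3 * r) := by
        rw [Finset.sum_const, Finset.card_univ, Fintype.card_fin, nsmul_eq_mul]
        ring
    _ ≤ (m + m) * (6 * m ^ 3 * r) := by gcongr
    _ = 12 * m ^ 4 * r := by ring

end Memory

section Total

variable [IsProbabilityMeasure μ] [Nonempty (Fin m)] (hrun : IsRun μ F P O H Gf D)
  (hP : P.Admissible H.lam Lf Lg rho) (hO : O.Valid P Gg) (hT : 0 < H.T₁)
  (hz : z ∈ P.feasible)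
include hrun hP hO hT hz

omit [Nonempty (Fin m)] in
theorem sum_integral_inner_secondDir_le (hγ : 0 ≤ H.γ) (hlam : 0 < H.lam) :
    ∑ n ∈ Finset.range H.T₂,
        (∫ ω, inner ℝ (secondDir P O H (D ω) n) ((secondPhase P O H (D ω) n).val.w - z) ∂μ
          - H.lam / 2 * ∫ ω, ‖(secondPhase P O H (D ω) n).val.w - z‖ ^ 2 ∂μ)
      ≤ H.lam / 2 * H.T₁ * ∫ ω, ‖firstAverage P O H (D ω) - z‖ ^ 2 ∂μ
        + (Gf + H.γ * Gg) ^ 2 / (2 * H.lam)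
          * ∑ n ∈ Finset.range H.T₂, 1 / ((H.T₁ + n + 1 : ℕ) : ℝ) := by
  have hA {n : ℕ} (hn : n < H.T₂) :=
    integrable_inner_secondDir (z := z) hrun hP hO hT hn ⟨z, hz.1⟩
  have hX {n : ℕ} (hn : n < H.T₂) :=
    (integrable_secondPhase_norm_sub_sq (μ := μ) hrun hP hO hz.1 hT hn.le).const_mul (H.lam / 2)
  have hY := (integrable_firstAverage_norm_sub_sq (μ := μ) hrun hP hO hz.1 hT).const_mul
    (H.lam / 2 * H.T₁)
  refine (Finset.sum_congr rfl fun n hn => ?_).trans_le ((sum_integral_le_of_ae_sum_le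
    (fun n hn => (hA (Finset.mem_range.1 hn)).sub (hX (Finset.mem_range.1 hn)))
    (hY.add (integrable_const _)) ((ae_norm_sg_le hrun).mono fun ω hω =>
      sum_inner_secondDir_le hP hO (hrun.init_mem ω) hγ hω hT hlam hz.1)).trans_eq ?_)
  · simp only [Pi.sub_apply]
    rw [integral_sub (hA (Finset.mem_range.1 hn)) (hX (Finset.mem_range.1 hn)),
      integral_const_mul]
  · simp only [Pi.add_apply]
    rw [integral_add hY (integrable_const _), integral_const_mul, integral_const, probReal_univ,
      one_smul]

theorem sum_integral_weightRegret_le_memCost (hγ : 0 < H.γ) (hlam : 0 < H.lam) (hLg : 0 < Lg)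
    (hη : H.η = H.lam / (2 * H.γ ^ 2 * Lg ^ 2)) (hq : q ∈ stdSimplex ℝ (Fin m)) :
    ∑ n ∈ Finset.range H.T₂, (∫ ω, weightRegret P O H (D ω) q n ∂μ
        - (H.lam / 8 * ∫ ω, ‖(secondPhase P O H (D ω) n).val.w - z‖ ^ 2 ∂μ
          + H.lam / Lg ^ 2 * ∫ ω, memCost P O H (D ω) n ∂μ))
      ≤ 2 * H.γ ^ 2 * Lg ^ 2 / H.lam * Real.log m := by
  have hR {n : ℕ} (hn : n < H.T₂) :=
    integrable_weightRegret hrun hP hO hT hn ⟨z, hz.1⟩ q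
  have hX {n : ℕ} (hn : n < H.T₂) :=
    (integrable_secondPhase_norm_sub_sq (μ := μ) hrun hP hO hz.1 hT hn.le).const_mul (H.lam / 8)
  have hE {n : ℕ} (hn : n < H.T₂) := (boundedMeasurable_memCost hrun hP hO hT hn
    ⟨z, hz.1⟩).integrable (μ := μ).const_mul (H.lam / Lg ^ 2)
  refine (Finset.sum_congr rfl fun n hn => ?_).trans_le ((sum_integral_le_of_ae_sum_le
    (fun n hn => (hR (Finset.mem_range.1 hn)).sub
      ((hX (Finset.mem_range.1 hn)).add (hE (Finset.mem_range.1 hn))))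
    (integrable_const (2 * H.γ ^ 2 * Lg ^ 2 / H.lam * Real.log m))
    (ae_of_all _ fun ω => ?_)).trans_eq ?_)
  · have hn := Finset.mem_range.1 hn
    rw [integral_sub' (hR hn) ((hX hn).add (hE hn)), integral_add' (hX hn) (hE hn),
      integral_const_mul, integral_const_mul]
  · have hregret := sum_weightRegret_le (O := O) hP hz (hrun.init_mem ω) hT hγ hlam hLg hη hq H.T₂
    simp only [Pi.sub_apply, Pi.add_apply, Finset.sum_sub_distrib]
    exact sub_le_iff_le_add.2 hregret
  · rw [integral_const, probReal_univ, one_smul]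

theorem sum_integral_weightRegret_le (hγ : 0 < H.γ) (hlam : 0 < H.lam) (hLg : 0 < Lg)
    (hη : H.η = H.lam / (2 * H.γ ^ 2 * Lg ^ 2)) (hq : q ∈ stdSimplex ℝ (Fin m)) :
    ∑ n ∈ Finset.range H.T₂, (∫ ω, weightRegret P O H (D ω) q n ∂μ
        - H.lam / 8 * ∫ ω, ‖(secondPhase P O H (D ω) n).val.w - z‖ ^ 2 ∂μ)
      ≤ 2 * H.γ ^ 2 * Lg ^ 2 / H.lam * Real.log m
        + H.T₂ * (12 * m ^ 4 * (Gf + H.γ * Gg) ^ 2 / (H.lam * H.T₁ ^ 2)) := by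
  have hcost {n : ℕ} (hn : n < H.T₂) : H.lam / Lg ^ 2 * ∫ ω, memCost P O H (D ω) n ∂μ
      ≤ 12 * m ^ 4 * (Gf + H.γ * Gg) ^ 2 / (H.lam * H.T₁ ^ 2) := by
    refine (mul_le_mul_of_nonneg_left (integral_memCost_le hrun hP hO hT hγ.le hlam hLg.le
      ⟨z, hz.1⟩ hn) (by positivity)).trans_eq ?_
    field_simp
  have hcosts := Finset.sum_le_sum fun n hn => hcost (Finset.mem_range.1 hn)
  have hregret := sum_integral_weightRegret_le_memCost hrun hP hO hT hz hγ hlam hLg hη hq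
  rw [Finset.sum_const, Finset.card_range, nsmul_eq_mul] at hcosts
  simp only [Finset.sum_sub_distrib, Finset.sum_add_distrib] at hregret ⊢
  linarith

theorem sum_integral_secondPhase_le (hγ : 0 < H.γ) (hlam : 0 < H.lam) (hLg : 0 < Lg)
    (hη : H.η = H.lam / (2 * H.γ ^ 2 * Lg ^ 2)) (hq : q ∈ stdSimplex ℝ (Fin m))
    (hgrowth : ∀ w ∈ P.W, P.f z + H.lam / 2 * ‖w - z‖ ^ 2 ≤ P.penalized H.γ q w) :
    3 / 8 * H.lam
        * ∑ n ∈ Finset.range H.T₂, ∫ ω, ‖(secondPhase P O H (D ω) n).val.w - z‖ ^ 2 ∂μ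
      ≤ H.lam / 2 * H.T₁ * ∫ ω, ‖firstAverage P O H (D ω) - z‖ ^ 2 ∂μ
        + (Gf + H.γ * Gg) ^ 2 / (2 * H.lam)
          * ∑ n ∈ Finset.range H.T₂, 1 / ((H.T₁ + n + 1 : ℕ) : ℝ)
        + (2 * H.γ ^ 2 * Lg ^ 2 / H.lam * Real.log m
          + H.T₂ * (12 * m ^ 4 * (Gf + H.γ * Gg) ^ 2 / (H.lam * H.T₁ ^ 2))) := by
  refine le_trans ?_ (add_le_add (sum_integral_inner_secondDir_le hrun hP hO hT hz hγ.le hlam)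
    (sum_integral_weightRegret_le hrun hP hO hT hz hγ hlam hLg hη hq))
  rw [Finset.mul_sum, ← Finset.sum_add_distrib]
  refine Finset.sum_le_sum fun n hn => ?_
  have hgap := mul_integral_secondPhase_le hrun hP hO hT (Finset.mem_range.1 hn) hz hγ.le hgrowth
  linarith

omit [IsProbabilityMeasure μ] [Nonempty (Fin m)] in
theorem mul_integral_average_le [IsFiniteMeasure μ] (hT₂ : 0 < H.T₂) :
    H.T₂ * ∫ ω, ‖average P O H (D ω) - z‖ ^ 2 ∂μ
      ≤ ∑ n ∈ Finset.range H.T₂, ∫ ω, ‖(secondPhase P O H (D ω) n).val.w - z‖ ^ 2 ∂μ := by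
  have hX (n : ℕ) (hn : n ∈ Finset.range H.T₂) :=
    integrable_secondPhase_norm_sub_sq (μ := μ) hrun hP hO hz.1 hT (Finset.mem_range.1 hn).le
  rw [← integral_finsetSum _ hX, ← le_inv_mul_iff₀ (Nat.cast_pos.2 hT₂), ← one_div,
    ← integral_const_mul]
  exact integral_mono (integrable_average_norm_sub_sq hrun hP hO hz.1 hT hT₂)
    ((integrable_finsetSum _ hX).const_mul _) fun ω => norm_average_sub_sq_le _ _ hT₂

theorem mul_integral_average_le_error (hT₂ : 0 < H.T₂) (hγ : 0 < H.γ) (hlam : 0 < H.lam)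
    (hLg : 0 < Lg) (hη : H.η = H.lam / (2 * H.γ ^ 2 * Lg ^ 2)) (hq : q ∈ stdSimplex ℝ (Fin m))
    (hgrowth : ∀ w ∈ P.W, P.f z + H.lam / 2 * ‖w - z‖ ^ 2 ≤ P.penalized H.γ q w) :
    3 / 8 * H.lam * (H.T₂ * ∫ ω, ‖average P O H (D ω) - z‖ ^ 2 ∂μ)
      ≤ (Gf + H.γ * Gg) ^ 2 / (2 * H.lam) * (1 + Real.log (H.T₁ + H.T₂))
        + 2 * H.γ ^ 2 * Lg ^ 2 / H.lam * Real.log m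
        + H.T₂ * (12 * m ^ 4 * (Gf + H.γ * Gg) ^ 2 / (H.lam * H.T₁ ^ 2)) := by
  have hfirst := integral_firstAverage_le hrun hP hO hz hγ.le hq hgrowth hlam hT
  have hsecond := sum_integral_secondPhase_le hrun hP hO hT hz hγ hlam hLg hη hq hgrowth
  have hjensen := mul_le_mul_of_nonneg_left (mul_integral_average_le hrun hP hO hT hz hT₂)
    (by positivity : 0 ≤ 3 / 8 * H.lam)
  have hsteps := mul_le_mul_of_nonneg_left (sum_one_div_add_sum_one_div_le H.T₁ H.T₂)
    (by positivity : 0 ≤ (Gf + H.γ * Gg) ^ 2 / (2 * H.lam))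
  rw [mul_add] at hsteps
  linarith

end Total

end SecondPhase

section Rates

/-- The square of the scale of the stochastic gradients relative to `lam * √ε`; `logTerm` is
`1 + log (1 + sqNoiseRatio)`. -/
noncomputable def sqNoiseRatio (γ lam Lg Gf Gg ε : ℝ) : ℝ :=
  (Gf + γ * Gg + γ * Lg) ^ 2 / (lam ^ 2 * ε)

/-- The length of the first phase, at which the memory errors of the second phase contribute at
most half of the admissible error. -/
noncomputable def phaseLength₁ (m : ℕ) (γ lam Gf Gg ε : ℝ) : ℕ :=
  ⌈8 * ((m : ℝ) ^ 2 * (Gf + γ * Gg) / (lam * √ε))⌉₊ + 1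

/-- The length of the second phase, at which the regrets contribute at most half of the admissible
error. -/
noncomputable def phaseLength₂ (m : ℕ) (γ lam Lg Gf Gg ε : ℝ) : ℕ :=
  ⌈64 * ((1 + Real.log m) * logTerm γ lam Lg Gf Gg ε * sqNoiseRatio γ lam Lg Gf Gg ε)⌉₊ + 1

variable {m : ℕ} {γ lam Lg Gf Gg ε : ℝ}

theorem one_le_one_add_log_natCast (m : ℕ) : 1 ≤ 1 + Real.log m :=
  le_add_of_nonneg_right (Real.log_natCast_nonneg m)

theorem natCast_ceil_add_one_le {x : ℝ} (hx : 0 ≤ x) : ((⌈x⌉₊ + 1 : ℕ) : ℝ) ≤ x + 2 := by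
  push_cast
  linarith [Nat.ceil_lt_add_one hx]

theorem le_phaseLength₁ :
    8 * ((m : ℝ) ^ 2 * (Gf + γ * Gg) / (lam * √ε)) ≤ phaseLength₁ m γ lam Gf Gg ε :=
  (Nat.le_ceil _).trans (Nat.cast_le.2 (Nat.le_succ _))

theorem le_phaseLength₂ :
    64 * ((1 + Real.log m) * logTerm γ lam Lg Gf Gg ε * sqNoiseRatio γ lam Lg Gf Gg ε)
      ≤ phaseLength₂ m γ lam Lg Gf Gg ε :=
  (Nat.le_ceil _).trans (Nat.cast_le.2 (Nat.le_succ _))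

theorem one_le_phaseLength₁ : (1 : ℝ) ≤ phaseLength₁ m γ lam Gf Gg ε :=
  Nat.one_le_cast.2 (Nat.succ_pos _)

section Nonneg

variable (hε : 0 ≤ ε)
include hε

theorem sqNoiseRatio_nonneg : 0 ≤ sqNoiseRatio γ lam Lg Gf Gg ε := by
  unfold sqNoiseRatio
  positivity

theorem one_le_logTerm : 1 ≤ logTerm γ lam Lg Gf Gg ε :=
  le_add_of_nonneg_right (Real.log_nonneg (le_add_of_nonneg_right (sqNoiseRatio_nonneg hε)))

theorem logTerm_le : logTerm γ lam Lg Gf Gg ε ≤ 1 + sqNoiseRatio γ lam Lg Gf Gg ε := by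
  have hpos : 0 < 1 + sqNoiseRatio γ lam Lg Gf Gg ε := by
    linarith [sqNoiseRatio_nonneg (γ := γ) (lam := lam) (Lg := Lg) (Gf := Gf) (Gg := Gg) hε]
  have hlog := Real.log_le_sub_one_of_pos hpos
  simp only [sqNoiseRatio, logTerm] at hlog ⊢
  linarith

theorem phaseLength₂_le : (phaseLength₂ m γ lam Lg Gf Gg ε : ℝ)
    ≤ 64 * ((1 + Real.log m) * logTerm γ lam Lg Gf Gg ε * sqNoiseRatio γ lam Lg Gf Gg ε)
      + 2 :=
  natCast_ceil_add_one_le (mul_nonneg (by norm_num) (mul_nonneg (mul_nonneg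
    (zero_le_one.trans (one_le_one_add_log_natCast m)) (zero_le_one.trans (one_le_logTerm hε)))
    (sqNoiseRatio_nonneg hε)))

theorem phaseLength₂_le_mul_logTerm : (phaseLength₂ m γ lam Lg Gf Gg ε : ℝ)
    ≤ 64 * ((1 + Real.log m) * (Gf + γ * Gg + γ * Lg) ^ 2 / (lam ^ 2 * ε)
      * logTerm γ lam Lg Gf Gg ε) + 2 := by
  refine phaseLength₂_le hε |>.trans_eq ?_
  rw [sqNoiseRatio]
  ring

end Nonneg

section Positivity

variable (hγ : 0 ≤ γ) (hlam : 0 < lam) (hGf : 0 ≤ Gf) (hGg : 0 ≤ Gg) (hε : 0 < ε)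
include hγ hlam hGf hGg

theorem phaseLength₁_le :
    (phaseLength₁ m γ lam Gf Gg ε : ℝ) ≤ 8 * ((m : ℝ) ^ 2 * (Gf + γ * Gg) / (lam * √ε)) + 2 :=
  natCast_ceil_add_one_le (by positivity)

theorem checks_firstPhase_le (hm : 0 < m) : (phaseLength₁ m γ lam Gf Gg ε : ℝ) * (m + 1)
    ≤ 16 * ((m : ℝ) ^ 3 * (1 + Real.log m) * (Gf + γ * Gg) / (lam * √ε)) + 4 * m := by
  have hm1 : (1 : ℝ) ≤ m := Nat.one_le_cast.2 hm
  calc (phaseLength₁ m γ lam Gf Gg ε : ℝ) * (m + 1)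
      ≤ (8 * ((m : ℝ) ^ 2 * (Gf + γ * Gg) / (lam * √ε)) + 2) * (m + m) := by
        gcongr
        exact phaseLength₁_le hγ hlam hGf hGg
    _ = 16 * ((m : ℝ) ^ 3 * 1 * (Gf + γ * Gg) / (lam * √ε)) + 4 * m := by ring
    _ ≤ 16 * ((m : ℝ) ^ 3 * (1 + Real.log m) * (Gf + γ * Gg) / (lam * √ε)) + 4 * m := by
        gcongr
        exact one_le_one_add_log_natCast m

variable (hLg : 0 ≤ Lg)
include hLg

theorem phaseLength₁_le_rate (hε : 0 ≤ ε) : (phaseLength₁ m γ lam Gf Gg ε : ℝ)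
    ≤ 128 * (1 + rate₁ m γ lam Lg Gf Gg ε) * logTerm γ lam Lg Gf Gg ε ^ 1 := by
  have hℓ := one_le_one_add_log_natCast m
  have hfirst : 0 ≤ m * (1 + Real.log m) ^ (2 / 3 : ℝ) * (Gf + γ * Gg + γ * Lg) ^ (4 / 3 : ℝ)
      / (lam ^ (4 / 3 : ℝ) * ε ^ (2 / 3 : ℝ)) := by
    have : 0 ≤ 1 + Real.log m := zero_le_one.trans hℓ
    positivity
  have hsecond : (m : ℝ) ^ 2 * (Gf + γ * Gg) / (lam * √ε)
      ≤ (m : ℝ) ^ 2 * (1 + Real.log m) * (Gf + γ * Gg) / (lam * √ε) := by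
    gcongr
    exact le_mul_of_one_le_right (by positivity) hℓ
  have hlength : 0 ≤ (m : ℝ) ^ 2 * (Gf + γ * Gg) / (lam * √ε) := by positivity
  rw [pow_one]
  refine (phaseLength₁_le hγ hlam hGf hGg).trans (le_trans ?_
    (le_mul_of_one_le_right ?_ (one_le_logTerm hε))) <;> unfold rate₁ <;> linarith

include hε

omit hGf hGg in
theorem div_le_one_add_sqNoiseRatio :
    (Gf + γ * Gg) / (lam * √ε) ≤ 1 + sqNoiseRatio γ lam Lg Gf Gg ε := by
  have hmono : (Gf + γ * Gg) / (lam * √ε) ≤ (Gf + γ * Gg + γ * Lg) / (lam * √ε) :=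
    div_le_div_of_nonneg_right (le_add_of_nonneg_right (mul_nonneg hγ hLg)) (by positivity)
  have hsq : sqNoiseRatio γ lam Lg Gf Gg ε = ((Gf + γ * Gg + γ * Lg) / (lam * √ε)) ^ 2 := by
    rw [sqNoiseRatio, div_pow, mul_pow, Real.sq_sqrt hε.le]
  nlinarith [sq_nonneg ((Gf + γ * Gg + γ * Lg) / (lam * √ε) - 1)]

theorem phaseLength₁_add_phaseLength₂_le (hm : 0 < m) :
    (phaseLength₁ m γ lam Gf Gg ε : ℝ) + phaseLength₂ m γ lam Lg Gf Gg ε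
      ≤ 76 * ((m : ℝ) ^ 2 * (1 + sqNoiseRatio γ lam Lg Gf Gg ε) ^ 2) := by
  have hm1 : (1 : ℝ) ≤ m := Nat.one_le_cast.2 hm
  have hX := sqNoiseRatio_nonneg (γ := γ) (lam := lam) (Lg := Lg) (Gf := Gf) (Gg := Gg) hε.le
  have hratio := div_le_one_add_sqNoiseRatio (Gf := Gf) (Gg := Gg) hγ hlam hε hLg
  have hΛ := one_le_logTerm (γ := γ) (lam := lam) (Lg := Lg) (Gf := Gf) (Gg := Gg) hε.le
  have hΛU := logTerm_le (γ := γ) (lam := lam) (Lg := Lg) (Gf := Gf) (Gg := Gg) hε.le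
  set U := 1 + sqNoiseRatio γ lam Lg Gf Gg ε
  have hU : 1 ≤ U := le_add_of_nonneg_right hX
  have hlogm : 1 + Real.log m ≤ m := by
    linarith [Real.log_le_sub_one_of_pos (zero_lt_one.trans_le hm1)]
  have hone : 1 ≤ (m : ℝ) ^ 2 * U ^ 2 :=
    one_le_mul_of_one_le_of_one_le (one_le_pow₀ hm1) (one_le_pow₀ hU)
  have hfirst : (m : ℝ) ^ 2 * (Gf + γ * Gg) / (lam * √ε) ≤ (m : ℝ) ^ 2 * U ^ 2 := by
    rw [mul_div_assoc]
    gcongr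
    exact hratio.trans (le_self_pow₀ hU two_ne_zero)
  have hsecond : (1 + Real.log m) * logTerm γ lam Lg Gf Gg ε * sqNoiseRatio γ lam Lg Gf Gg ε
      ≤ (m : ℝ) ^ 2 * U ^ 2 := by
    calc (1 + Real.log m) * logTerm γ lam Lg Gf Gg ε * sqNoiseRatio γ lam Lg Gf Gg ε
        ≤ m * U * U := by
          gcongr
          exact le_add_of_nonneg_left zero_le_one
      _ = m * U ^ 2 := by ring
      _ ≤ (m : ℝ) ^ 2 * U ^ 2 := by
          gcongr
          exact le_self_pow₀ hm1 two_ne_zero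
  linarith [phaseLength₁_le (m := m) (ε := ε) hγ hlam hGf hGg,
    phaseLength₂_le (m := m) (γ := γ) (lam := lam) (Lg := Lg) (Gf := Gf) (Gg := Gg) hε.le]

omit hγ hlam hGf hGg hε hLg in
theorem log_seventySix_le : Real.log 76 ≤ 5 := by
  rw [Real.log_le_iff_le_exp (by norm_num)]
  calc (76 : ℝ) ≤ 2.7 ^ 5 := by norm_num
    _ ≤ Real.exp 1 ^ 5 := by gcongr; linarith [Real.exp_one_gt_d9]
    _ = Real.exp 5 := by rw [Real.exp_one_pow]; norm_num

theorem log_phaseLength_le (hm : 0 < m) :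
    (1 + Real.log (phaseLength₁ m γ lam Gf Gg ε + phaseLength₂ m γ lam Lg Gf Gg ε)) / 2
      + 2 * Real.log m ≤ 12 * ((1 + Real.log m) * logTerm γ lam Lg Gf Gg ε) := by
  have hU : 0 < 1 + sqNoiseRatio γ lam Lg Gf Gg ε := zero_lt_one.trans_le
    (le_add_of_nonneg_right (sqNoiseRatio_nonneg hε.le))
  have hlog := Real.log_le_log (add_pos_of_pos_of_nonneg
    (zero_lt_one.trans_le one_le_phaseLength₁) (Nat.cast_nonneg _))
    (phaseLength₁_add_phaseLength₂_le hγ hlam hGf hGg hε hLg hm)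
  rw [Real.log_mul (by norm_num) (by positivity), Real.log_mul (by positivity) (by positivity),
    Real.log_pow, Real.log_pow] at hlog
  have hΛ : logTerm γ lam Lg Gf Gg ε = 1 + Real.log (1 + sqNoiseRatio γ lam Lg Gf Gg ε) := rfl
  have hprod := mul_nonneg (Real.log_natCast_nonneg m)
    (sub_nonneg.2 (one_le_logTerm (γ := γ) (lam := lam) (Lg := Lg) (Gf := Gf) (Gg := Gg) hε.le))
  have hΛ1 := one_le_logTerm (γ := γ) (lam := lam) (Lg := Lg) (Gf := Gf) (Gg := Gg) hε.le
  push_cast at hlog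
  linarith [log_seventySix_le, Real.log_natCast_nonneg m]

omit hLg in
theorem memory_error_le (hm : 0 < m) :
    12 * (m : ℝ) ^ 4 * (Gf + γ * Gg) ^ 2 / (lam * (phaseLength₁ m γ lam Gf Gg ε : ℝ) ^ 2)
      ≤ 3 / 16 * lam * ε := by
  have hpos := zero_lt_one.trans_le (one_le_phaseLength₁ (m := m) (γ := γ) (lam := lam)
    (Gf := Gf) (Gg := Gg) (ε := ε))
  have hsq := pow_le_pow_left₀ (by positivity)
    (le_phaseLength₁ (m := m) (γ := γ) (lam := lam) (Gf := Gf) (Gg := Gg) (ε := ε)) 2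
  rw [mul_pow, div_pow, mul_pow lam, Real.sq_sqrt hε.le, ← mul_div_assoc,
    div_le_iff₀ (by positivity)] at hsq
  rw [div_le_iff₀ (by positivity)]
  linarith

theorem regret_error_le (hm : 0 < m) :
    (Gf + γ * Gg) ^ 2 / (2 * lam)
        * (1 + Real.log (phaseLength₁ m γ lam Gf Gg ε + phaseLength₂ m γ lam Lg Gf Gg ε))
      + 2 * γ ^ 2 * Lg ^ 2 / lam * Real.log m
      ≤ 3 / 16 * lam * ε * phaseLength₂ m γ lam Lg Gf Gg ε := by
  have hlength : 0 ≤ Real.log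
      (phaseLength₁ m γ lam Gf Gg ε + phaseLength₂ m γ lam Lg Gf Gg ε) :=
    Real.log_nonneg (one_le_phaseLength₁.trans (le_add_of_nonneg_right (Nat.cast_nonneg _)))
  have := Real.log_natCast_nonneg m
  have hlog := log_phaseLength_le hγ hlam hGf hGg hε hLg hm
  set L := Real.log (phaseLength₁ m γ lam Gf Gg ε + phaseLength₂ m γ lam Lg Gf Gg ε)
  set S := Gf + γ * Gg + γ * Lg
  have hGS : Gf + γ * Gg ≤ S := le_add_of_nonneg_right (by positivity)
  have hLS : γ * Lg ≤ S := le_add_of_nonneg_left (by positivity)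
  calc (Gf + γ * Gg) ^ 2 / (2 * lam) * (1 + L) + 2 * γ ^ 2 * Lg ^ 2 / lam * Real.log m
      = (Gf + γ * Gg) ^ 2 / (2 * lam) * (1 + L) + 2 * (γ * Lg) ^ 2 / lam * Real.log m := by ring
    _ ≤ S ^ 2 / (2 * lam) * (1 + L) + 2 * S ^ 2 / lam * Real.log m := by gcongr
    _ = S ^ 2 / lam * ((1 + L) / 2 + 2 * Real.log m) := by field_simp
    _ ≤ S ^ 2 / lam * (12 * ((1 + Real.log m) * logTerm γ lam Lg Gf Gg ε)) := by gcongr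
    _ = 3 / 16 * lam * ε * (64 * ((1 + Real.log m) * logTerm γ lam Lg Gf Gg ε
          * sqNoiseRatio γ lam Lg Gf Gg ε)) := by
        rw [sqNoiseRatio]
        field_simp
        ring
    _ ≤ 3 / 16 * lam * ε * phaseLength₂ m γ lam Lg Gf Gg ε := by
        gcongr
        exact le_phaseLength₂

theorem le_of_mul_le_error (hm : 0 < m) {s : ℝ}
    (hs : 3 / 8 * lam * (phaseLength₂ m γ lam Lg Gf Gg ε * s) ≤ (Gf + γ * Gg) ^ 2 / (2 * lam)
        * (1 + Real.log (phaseLength₁ m γ lam Gf Gg ε + phaseLength₂ m γ lam Lg Gf Gg ε))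
      + 2 * γ ^ 2 * Lg ^ 2 / lam * Real.log m
      + phaseLength₂ m γ lam Lg Gf Gg ε * (12 * m ^ 4 * (Gf + γ * Gg) ^ 2
        / (lam * (phaseLength₁ m γ lam Gf Gg ε : ℝ) ^ 2))) :
    s ≤ ε := by
  have hlength : (0 : ℝ) < phaseLength₂ m γ lam Lg Gf Gg ε := Nat.cast_pos.2 (Nat.succ_pos _)
  have hregret := regret_error_le hγ hlam hGf hGg hε hLg hm
  have hmemory := mul_le_mul_of_nonneg_left (memory_error_le hγ hlam hGf hGg hε hm) hlength.le
  have hscaled : 3 / 8 * lam * phaseLength₂ m γ lam Lg Gf Gg ε * s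
      ≤ 3 / 8 * lam * phaseLength₂ m γ lam Lg Gf Gg ε * ε := by
    linarith
  exact le_of_mul_le_mul_left hscaled (by positivity)

omit hLg in
theorem phaseLength₂_le_rate : (phaseLength₂ m γ lam Lg Gf Gg ε : ℝ)
    ≤ 128 * (1 + rate₂ m γ lam Lg Gf Gg ε) * logTerm γ lam Lg Gf Gg ε ^ 1 := by
  have : 0 ≤ 1 + Real.log m := zero_le_one.trans (one_le_one_add_log_natCast m)
  have hΛ := one_le_logTerm (γ := γ) (lam := lam) (Lg := Lg) (Gf := Gf) (Gg := Gg) hε.le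
  have hlength := phaseLength₂_le_mul_logTerm (m := m) (γ := γ) (lam := lam) (Lg := Lg)
    (Gf := Gf) (Gg := Gg) hε.le
  rw [rate₂, pow_one]
  set A := (1 + Real.log m) * (Gf + γ * Gg + γ * Lg) ^ 2 / (lam ^ 2 * ε)
  set B := (m : ℝ) ^ (3 / 2 : ℝ) * (1 + Real.log m) ^ (3 / 2 : ℝ) * (Gf + γ * Gg) ^ (3 / 2 : ℝ)
      / (lam ^ (3 / 2 : ℝ) * ε ^ (3 / 4 : ℝ))
  set Λ := logTerm γ lam Lg Gf Gg ε
  have hAΛ : 0 ≤ A * Λ := by positivity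
  have hBΛ : 0 ≤ B * Λ := by positivity
  linarith

theorem checks_le_rate (hm : 0 < m) :
    ((phaseLength₁ m γ lam Gf Gg ε * (m + 1) + m + 2 * phaseLength₂ m γ lam Lg Gf Gg ε : ℕ) : ℝ)
      ≤ 128 * (m + checkRate m γ lam Lg Gf Gg ε) * logTerm γ lam Lg Gf Gg ε ^ 1 := by
  have hm1 : (1 : ℝ) ≤ m := Nat.one_le_cast.2 hm
  have : 0 ≤ 1 + Real.log m := zero_le_one.trans (one_le_one_add_log_natCast m)
  have hΛ := one_le_logTerm (γ := γ) (lam := lam) (Lg := Lg) (Gf := Gf) (Gg := Gg) hε.le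
  have hfirst := checks_firstPhase_le (ε := ε) hγ hlam hGf hGg hm
  have hsecond := phaseLength₂_le_mul_logTerm (m := m) (γ := γ) (lam := lam) (Lg := Lg)
    (Gf := Gf) (Gg := Gg) hε.le
  rw [checkRate, pow_one]
  set A := (1 + Real.log m) * (Gf + γ * Gg + γ * Lg) ^ 2 / (lam ^ 2 * ε)
  set B := (m : ℝ) ^ (3 / 2 : ℝ) * (1 + Real.log m) ^ (3 / 2 : ℝ) * (Gf + γ * Gg) ^ (3 / 2 : ℝ)
      / (lam ^ (3 / 2 : ℝ) * ε ^ (3 / 4 : ℝ))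
  set E := (m : ℝ) ^ 2 * (1 + Real.log m) ^ (2 / 3 : ℝ) * (Gf + γ * Gg + γ * Lg) ^ (4 / 3 : ℝ)
      / (lam ^ (4 / 3 : ℝ) * ε ^ (2 / 3 : ℝ))
  set K := (m : ℝ) ^ 3 * (1 + Real.log m) * (Gf + γ * Gg) / (lam * √ε)
  set Λ := logTerm γ lam Lg Gf Gg ε
  have hB0 : 0 ≤ B := by positivity
  have hE0 : 0 ≤ E := by positivity
  have hK0 : 0 ≤ K := by positivity
  have hΛ0 := sub_nonneg.2 hΛ
  push_cast
  linarith [mul_nonneg hB0 hΛ0, mul_nonneg hE0 hΛ0, mul_nonneg hK0 hΛ0,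
    mul_nonneg (zero_le_one.trans hm1) hΛ0]

end Positivity

end Rates

end MidTouch

theorem mainTheorem2 :
    ∃ (C : ℝ) (a : ℕ), 0 < C ∧
      ∀ (m : ℕ) (γ lam Lg Gf Gg ε : ℝ),
        0 < m → 0 < γ → 0 < lam → 0 < Lg → 0 ≤ Gf → 0 ≤ Gg → 0 < ε →
        ∃ T₁ T₂ : ℕ, 0 < T₁ ∧ 0 < T₂ ∧
          (T₁ : ℝ) ≤ C * (1 + MidTouch.rate₁ m γ lam Lg Gf Gg ε)
            * MidTouch.logTerm γ lam Lg Gf Gg ε ^ a ∧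
          (T₂ : ℝ) ≤ C * (1 + MidTouch.rate₂ m γ lam Lg Gf Gg ε)
            * MidTouch.logTerm γ lam Lg Gf Gg ε ^ a ∧
          ∀ (d : ℕ) (P : MidTouch.Problem d m) (O : MidTouch.Oracle d m) (Lf rho : ℝ)
            (wstar : MidTouch.Vec d),
            P.Admissible lam Lf Lg rho → Lf / rho < γ → O.Valid P Gg → P.IsOptimum wstar →
            ∀ (H : MidTouch.Hyper),
              H = ⟨γ, lam, lam / (2 * γ ^ 2 * Lg ^ 2), T₁, T₂⟩ →
              (∀ D : MidTouch.Draws d m,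
                (MidTouch.totalChecks P O H D : ℝ)
                  ≤ C * (m + MidTouch.checkRate m γ lam Lg Gf Gg ε)
                    * MidTouch.logTerm γ lam Lg Gf Gg ε ^ a) ∧
              ∀ (Ω : Type*) (mΩ : MeasurableSpace Ω) (μ : MeasureTheory.Measure Ω)
                (F : MeasureTheory.Filtration ℕ mΩ) (D : Ω → MidTouch.Draws d m),
                MeasureTheory.IsProbabilityMeasure μ →
                MidTouch.IsRun μ F P O H Gf D →
                MeasureTheory.Integrable (fun ω =>
                  ‖MidTouch.proj P.feasible (MidTouch.average P O H (D ω)) - wstar‖ ^ 2) μ ∧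
                MeasureTheory.Integrable (fun ω =>
                  ‖MidTouch.average P O H (D ω) - wstar‖ ^ 2) μ ∧
                ∫ ω, ‖MidTouch.proj P.feasible (MidTouch.average P O H (D ω)) - wstar‖ ^ 2 ∂μ
                  ≤ ∫ ω, ‖MidTouch.average P O H (D ω) - wstar‖ ^ 2 ∂μ ∧
                ∫ ω, ‖MidTouch.average P O H (D ω) - wstar‖ ^ 2 ∂μ ≤ ε := by
  refine ⟨128, 1, by norm_num, fun m γ lam Lg Gf Gg ε hm hγ hlam hLg hGf hGg hε =>
    ⟨MidTouch.phaseLength₁ m γ lam Gf Gg ε, MidTouch.phaseLength₂ m γ lam Lg Gf Gg ε,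
      Nat.succ_pos _, Nat.succ_pos _,
      MidTouch.phaseLength₁_le_rate hγ.le hlam hGf hGg hLg.le hε.le,
      MidTouch.phaseLength₂_le_rate hγ.le hlam hGf hGg hε, ?_⟩⟩
  rintro d P O Lf rho wstar hP hLf hO hopt H rfl
  have : Nonempty (Fin m) := Fin.pos_iff_nonempty.1 hm
  refine ⟨fun D => ?_, fun Ω mΩ μ F D hμ hrun => ?_⟩
  · rw [MidTouch.totalChecks_eq]
    exact MidTouch.checks_le_rate hγ.le hlam hGf hGg hε hLg.le hm
  obtain ⟨q, hq, hgrowth⟩ :=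
    MidTouch.exists_weights_penalized_growth hP hLf.le hγ.le hlam.le hopt
  have hbar := MidTouch.integrable_average_norm_sub_sq hrun hP hO hopt.1.1
    (Nat.succ_pos _) (Nat.succ_pos _)
  have hproj := MidTouch.integrable_proj_average_norm_sub_sq hrun hP hO hopt.1
  have herror := MidTouch.mul_integral_average_le_error hrun hP hO (Nat.succ_pos _) hopt.1
    (Nat.succ_pos _) hγ hlam hLg rfl hq hgrowth
  refine ⟨hproj, hbar, integral_mono hproj hbar fun ω => ?_,
    MidTouch.le_of_mul_le_error hγ.le hlam hGf hGg hε hLg.le hm herror⟩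
  exact pow_le_pow_left₀ (norm_nonneg _) (MidTouch.norm_proj_sub_le ⟨wstar, hopt.1⟩
    (MidTouch.isClosed_feasible hP) (MidTouch.convex_feasible hP) _ hopt.1) 2
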